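/- Let $n\ge 1$, $N=\binom n2$, and label $N$ qubits by the edges $\{i,j\}$ of the complete graph on $[n]$, ordered lexicographically as $\{1,2\},\{1,3\},\dots,\{1,n\},\{2,3\},\dots,\{n-1,n\}$; two qubits are neighbouring if they are consecutive in this order. A bit string $x=(x_{ij})_{i<j}\in\{0,1\}^N$ encodes the labelled graph $G(x)$ on $[n]$ in which $\{i,j\}$ is an edge iff $x_{ij}=1$, and $|x\rangle$ is the corresponding basis vector of $\otimes^N\mathbb C^2$. The group $S_n$ acts on bit strings by $(\pi(\sigma)x)_{\sigma(e)}=x_e$, so that $G(\pi(\sigma)x)=\sigma(G(x))$, and on $\otimes^N\mathbb C^2$ by the unitary representation $P(\sigma)|x\rangle=|\pi(\sigma)x\rangle$. Let $S=\{\tau_{1,n},\dots,\tau_{n-1,n}\}$ be the set of star transpositions. For a finite group $\mathcal G$ with a symmetric generating set $S\not\ni \mathrm{id}$, let $L(\mathcal G,S)=|S|I-A$ be the Laplacian of the Cayley graph with edges $g\sim hg$, $h\in S$, and call its second smallest eigenvalue (with multiplicity) its spectral gap. Elementary gates are one-qubit unitaries and CNOT gates. 1. (Efficient representation.) There are constants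 $b,\beta>0$ such that for all $n\ge 2$: $\log n!\le bN^\beta$; $S$ is a symmetric set of generators of $S_n$ not containing the identity; each $P(\tau)$, $\tau\in S$, is a product of at most $bN^\beta$ elementary gates; $|S|\le bN^\beta$; and the inverse of the spectral gap of $L(S_n,S)$ is at most $bN^\beta$. 2. For $n\ge 3$, $P$ is injective, $\log n!<\tfrac12\sqrt{2N}\,\log(2N)$, and the spectral gap of $L(S_n,S)$ is $1$. For every $n$ and every transposition $\tau\in S_n$, $P(\tau)$ is a product of at most $3!\binom n3$ swaps of neighbouring qubits, and of fewer than $3!\binom n3$ if $n\ge3$. 3. For all $n\ge 1$ and all $x$, let $\mathrm{orb}(x)$ and $H(x)$ be the orbit and the stabilizer of $x$ under $S_n$. Then $y\in\mathrm{orb}(x)$ iff $G(y)\cong G(x)$, and $|H(x)|=|\mathrm{Aut}\,G(x)|$. Let $$\rho(x)=\frac1{n!}\sum_{\sigma\in S_n}P(\sigma)|x\rangle\langle x|P(\sigma)^\dagger,\qquad Q_N(\eta)=\frac1n\sum_{g\in\{\mathrm{id}\}\cup S}P(g)\,\eta\,P(g)^\dagger .$$ Then $\rho(x)=\frac{|H(x)|}{n!}\sum_{y\in\mathrm{orb}(x)}|y\rangle\langle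 y|$; hence $\langle y|\rho(x)|y\rangle=\frac{|H(x)|}{n!}\ge\frac1{n!}$ for $y\in\mathrm{orb}(x)$. For every integer $l\ge0$ and every $y$, $|y\rangle$ is an eigenvector of $\rho(x)$ and of $Q_N^l(|x\rangle\langle x|)$ with eigenvalues $\langle y|\rho(x)|y\rangle$ and $\langle y|Q_N^l(|x\rangle\langle x|)|y\rangle$; if $y\notin\mathrm{orb}(x)$, both operators annihilate $|y\rangle$ and both eigenvalues are $0$. Moreover $$\bigl|\langle y|\bigl(\rho(x)-Q_N^l(|x\rangle\langle x|)\bigr)|y\rangle\bigr|\le\sqrt{|H(x)|}\,e^{-l/n}\le\sqrt{n!}\,e^{-l/n}.$$ -/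

import Mathlib

open scoped Matrix

/-! ### Systems of qubits

The qubits are labelled by a finite type `ι`; the computational basis of the `|ι|`-qubit space is
the set of bit strings `ι → Fin 2`, and operators are matrices in this basis. -/

/-- The basis vector `|x⟩`. -/
def ket {ι : Type*} [Fintype ι] [DecidableEq ι] (x : ι → Fin 2) : (ι → Fin 2) → ℂ :=
  Pi.single x 1

/-- The pure state `|x⟩⟨x|`. -/
def pureState {ι : Type*} [Fintype ι] [DecidableEq ι] (x : ι → Fin 2) :
    Matrix (ι → Fin 2) (ι → Fin 2) ℂ :=
  Matrix.vecMulVec (ket x) (star (ket x))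

/-- The number `⟨y|A|y⟩`. -/
def diagValue {ι : Type*} [Fintype ι] [DecidableEq ι]
    (A : Matrix (ι → Fin 2) (ι → Fin 2) ℂ) (y : ι → Fin 2) : ℂ :=
  star (ket y) ⬝ᵥ (A *ᵥ ket y)

/-- The permutation of the basis given by permuting the qubits: the content of qubit `i` is
moved to qubit `π i`. -/
def bitPerm (ι : Type*) : Equiv.Perm ι →* Equiv.Perm (ι → Fin 2) where
  toFun π := Equiv.arrowCongr π (Equiv.refl (Fin 2))
  map_one' := rfl
  map_mul' _ _ := rfl

/-- The unitary operator `|x⟩ ↦ |τ x⟩` of a permutation `τ` of the basis. -/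
def basisPermUnitary (B : Type*) [Fintype B] [DecidableEq B] :
    Equiv.Perm B →* Matrix.unitaryGroup B ℂ where
  toFun τ := ⟨Matrix.of fun y x => if y = τ x then 1 else 0, by
    rw [Matrix.mem_unitaryGroup_iff']
    ext i j
    simp [Matrix.mul_apply, Matrix.star_apply, Matrix.one_apply, eq_comm]⟩
  map_one' := by
    ext i j
    change (if i = j then (1 : ℂ) else 0) = (1 : Matrix B B ℂ) i j
    simp [Matrix.one_apply]
  map_mul' σ τ := by
    ext i j
    change (if i = σ (τ j) then (1 : ℂ) else 0) =
      ((Matrix.of fun y x => if y = σ x then (1 : ℂ) else 0) *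
        (Matrix.of fun y x => if y = τ x then (1 : ℂ) else 0) : Matrix B B ℂ) i j
    simp [Matrix.mul_apply]

/-- The gate that applies the one-qubit matrix `u` to the qubit `i`. -/
def oneQubitGate {ι : Type*} [Fintype ι] [DecidableEq ι] (i : ι) (u : Matrix (Fin 2) (Fin 2) ℂ) :
    Matrix (ι → Fin 2) (ι → Fin 2) ℂ :=
  Matrix.of fun y x => if ∀ k, k ≠ i → y k = x k then u (y i) (x i) else 0

/-- The controlled-NOT gate with control `i` and target `j` (addition in `Fin 2` is mod 2). -/
def cnotGate {ι : Type*} [Fintype ι] [DecidableEq ι] (i j : ι) :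
    Matrix (ι → Fin 2) (ι → Fin 2) ℂ :=
  Matrix.of fun y x => if y = Function.update x j (x j + x i) then 1 else 0

/-- The gate that swaps the qubits `i` and `j`. -/
def swapGate {ι : Type*} [Fintype ι] [DecidableEq ι] (i j : ι) :
    Matrix (ι → Fin 2) (ι → Fin 2) ℂ :=
  (basisPermUnitary (ι → Fin 2) (bitPerm ι (Equiv.swap i j)) :
    Matrix (ι → Fin 2) (ι → Fin 2) ℂ)

/-- The elementary quantum gates: one-qubit unitaries and controlled-NOT gates. -/
def IsElementaryGate {ι : Type*} [Fintype ι] [DecidableEq ι]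
    (U : Matrix (ι → Fin 2) (ι → Fin 2) ℂ) : Prop :=
  (∃ (i : ι) (u : Matrix (Fin 2) (Fin 2) ℂ),
      u ∈ Matrix.unitaryGroup (Fin 2) ℂ ∧ U = oneQubitGate i u) ∨
    ∃ i j : ι, i ≠ j ∧ U = cnotGate i j

/-! ### Cayley graphs and quantum channels of a represented group -/

/-- The Cayley graph: `g` is joined to `h * g` for `h ∈ S`. -/
def leftCayleyGraph {G : Type*} [Group G] (S : Finset G) : SimpleGraph G :=
  SimpleGraph.fromRel fun g k => ∃ h ∈ S, k = h * g

open Classical in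
/-- The second smallest eigenvalue, counted with multiplicity, of the Laplacian of the Cayley graph
(`0` if the group has fewer than two elements).
The eigenvalues `eigenvalues₀` are listed in decreasing order. -/
noncomputable def laplacianGap {G : Type*} [Group G] [Fintype G] (S : Finset G) : ℝ :=
  if h : 1 < Fintype.card G then
    ((leftCayleyGraph S).isHermitian_lapMatrix ℝ).eigenvalues₀ (Fin.rev ⟨1, h⟩)
  else 0

/-- The channel `ρ ↦ ∑ g, u g • g ρ g†` of a weight `u` on a group acting by `P`. -/
noncomputable def groupChannel {G ι : Type*} [Group G] [Fintype G] [Fintype ι] [DecidableEq ι]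
    (P : G →* Matrix.unitaryGroup (ι → Fin 2) ℂ) (u : G → ℝ)
    (ρ : Matrix (ι → Fin 2) (ι → Fin 2) ℂ) : Matrix (ι → Fin 2) (ι → Fin 2) ℂ :=
  ∑ g, (u g : ℂ) • ((P g : Matrix (ι → Fin 2) (ι → Fin 2) ℂ) * ρ *
    (P g : Matrix (ι → Fin 2) (ι → Fin 2) ℂ)ᴴ)

/-- The uniform channel of the whole group. -/
noncomputable def uniformChannel {G ι : Type*} [Group G] [Fintype G] [Fintype ι] [DecidableEq ι]
    (P : G →* Matrix.unitaryGroup (ι → Fin 2) ℂ) :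
    Matrix (ι → Fin 2) (ι → Fin 2) ℂ → Matrix (ι → Fin 2) (ι → Fin 2) ℂ :=
  groupChannel P fun _ => 1 / (Fintype.card G : ℝ)

/-- The channel of the uniform distribution on `{1} ∪ S` (where `1 ∉ S`). -/
noncomputable def generatorChannel {G ι : Type*} [Group G] [Fintype G] [DecidableEq G]
    [Fintype ι] [DecidableEq ι]
    (P : G →* Matrix.unitaryGroup (ι → Fin 2) ℂ) (S : Finset G) :
    Matrix (ι → Fin 2) (ι → Fin 2) ℂ → Matrix (ι → Fin 2) (ι → Fin 2) ℂ :=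
  groupChannel P fun g => if g ∈ insert 1 S then 1 / (1 + (S.card : ℝ)) else 0

/-- With `N` the number of qubits, the group is efficiently represented with constants `b`, `β`
with respect to the symmetric set of generators `S`. -/
structure EfficientlyRepresentedWith {G ι : Type*} [Group G] [Fintype G]
    [Fintype ι] [DecidableEq ι] (P : G →* Matrix.unitaryGroup (ι → Fin 2) ℂ)
    (S : Finset G) (b β : ℝ) : Prop where
  log_card_le : Real.log (Fintype.card G) ≤ b * (Fintype.card ι : ℝ) ^ β
  one_notMem : (1 : G) ∉ S
  symmetric : ∀ g, g ∈ S ↔ g⁻¹ ∈ S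
  generates : Subgroup.closure (S : Set G) = ⊤
  gates : ∀ g ∈ S, ∃ c : List (Matrix (ι → Fin 2) (ι → Fin 2) ℂ),
    (∀ U ∈ c, IsElementaryGate U) ∧ (c.length : ℝ) ≤ b * (Fintype.card ι : ℝ) ^ β ∧
      c.prod = (P g : Matrix (ι → Fin 2) (ι → Fin 2) ℂ)
  card_le : (S.card : ℝ) ≤ b * (Fintype.card ι : ℝ) ^ β
  gap_inv_le : (laplacianGap S)⁻¹ ≤ b * (Fintype.card ι : ℝ) ^ β

/-! ### Labelled graphs as basis states -/

/-- The edges of the complete graph on `n` vertices: two-element subsets of the vertex set. -/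
def Edge (n : ℕ) : Type := {e : Sym2 (Fin n) // ¬ e.IsDiag}

instance (n : ℕ) : DecidableEq (Edge n) :=
  inferInstanceAs (DecidableEq {e : Sym2 (Fin n) // ¬ e.IsDiag})

instance (n : ℕ) : Fintype (Edge n) :=
  inferInstanceAs (Fintype {e : Sym2 (Fin n) // ¬ e.IsDiag})

theorem card_edge (n : ℕ) : Fintype.card (Edge n) = n.choose 2 := by
  have h := Sym2.card_subtype_not_diag (α := Fin n)
  rw [Fintype.card_fin] at h
  rw [← h]
  exact Fintype.card_congr (Equiv.refl _)

/-- The edge `{i, j}`. -/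
def mkEdge {n : ℕ} (i j : Fin n) (h : i ≠ j) : Edge n := ⟨s(i, j), by simpa using h⟩

/-- The lexicographic key `(i, j)`, `i < j`, of an edge `{i, j}`. -/
def Edge.key {n : ℕ} (e : Edge n) : Fin n ×ₗ Fin n := toLex (e.1.inf, e.1.sup)

theorem Edge.key_injective (n : ℕ) : Function.Injective (Edge.key (n := n)) := by
  intro e f h
  have h' : (e.1.inf, e.1.sup) = (f.1.inf, f.1.sup) := toLex.injective h
  exact Subtype.ext (Sym2.inf_eq_inf_and_sup_eq_sup.mp (Prod.mk.inj h'))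

/-- The lexicographic order `{1,2}, {1,3}, …, {1,n}, {2,3}, …, {n-1,n}` of the edges;
neighbouring qubits are those that are consecutive in it. -/
instance (n : ℕ) : LinearOrder (Edge n) :=
  { PartialOrder.lift Edge.key (Edge.key_injective n) with
    le_total := fun e f => le_total e.key f.key
    toDecidableLE := fun e f => inferInstanceAs (Decidable (e.key ≤ f.key))
    toDecidableLT := fun e f => inferInstanceAs (Decidable (e.key < f.key))
    toDecidableEq := inferInstance }

/-- The image of an edge under a permutation of the vertices, `{i, j} ↦ {σ i, σ j}`. -/
def Edge.map {n : ℕ} (σ : Equiv.Perm (Fin n)) (e : Edge n) : Edge n :=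
  ⟨Sym2.map σ e.1, by
    obtain ⟨e, he⟩ := e
    induction e with | _ a b => simpa using he⟩

theorem Edge.map_one {n : ℕ} (e : Edge n) : Edge.map 1 e = e := by
  apply Subtype.ext
  change Sym2.map id e.1 = e.1
  simp

theorem Edge.map_mul {n : ℕ} (σ τ : Equiv.Perm (Fin n)) (e : Edge n) :
    Edge.map (σ * τ) e = Edge.map σ (Edge.map τ e) := by
  apply Subtype.ext
  change Sym2.map (σ ∘ τ) e.1 = Sym2.map σ (Sym2.map τ e.1)
  rw [Sym2.map_map]

/-- The action of the permutations of the vertices on the edges. -/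
def edgePerm (n : ℕ) : Equiv.Perm (Fin n) →* Equiv.Perm (Edge n) where
  toFun σ :=
    { toFun := Edge.map σ
      invFun := Edge.map σ⁻¹
      left_inv := fun e => by rw [← Edge.map_mul, inv_mul_cancel, Edge.map_one]
      right_inv := fun e => by rw [← Edge.map_mul, mul_inv_cancel, Edge.map_one] }
  map_one' := Equiv.ext fun e => Edge.map_one e
  map_mul' σ τ := Equiv.ext fun e => Edge.map_mul σ τ e

/-- The action of a permutation of the vertices on the bit strings `x = (x_e)_e` indexed by the
edges. -/
def graphPerm (n : ℕ) : Equiv.Perm (Fin n) →* Equiv.Perm (Edge n → Fin 2) :=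
  (bitPerm (Edge n)).comp (edgePerm n)

/-- The labelled graph `G(x)`: `{i, j}` is an edge if and only if `x_{ij} = 1`. -/
def graphOf {n : ℕ} (x : Edge n → Fin 2) : SimpleGraph (Fin n) where
  Adj i j := ∃ h : i ≠ j, x (mkEdge i j h) = 1
  symm := ⟨by
    rintro i j ⟨h, hx⟩
    refine ⟨h.symm, ?_⟩
    have : mkEdge j i h.symm = mkEdge i j h := Subtype.ext Sym2.eq_swap
    rw [this, hx]⟩
  loopless := ⟨fun _ h => h.1 rfl⟩

/-- The representation of the symmetric group on the edge qubits, `|x⟩ ↦ |π(σ) x⟩`. -/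
def graphRep (n : ℕ) : Equiv.Perm (Fin n) →* Matrix.unitaryGroup (Edge n → Fin 2) ℂ :=
  (basisPermUnitary (Edge n → Fin 2)).comp (graphPerm n)

/-- The orbit of `x` under the relabelling of the vertices. -/
def graphOrbit {n : ℕ} (x : Edge n → Fin 2) : Finset (Edge n → Fin 2) :=
  Finset.univ.image fun σ : Equiv.Perm (Fin n) => graphPerm n σ x

/-- The stabilizer of `x` in the symmetric group. -/
def graphStabilizer {n : ℕ} (x : Edge n → Fin 2) : Subgroup (Equiv.Perm (Fin n)) :=
  (MulAction.stabilizer (Equiv.Perm (Edge n → Fin 2)) x).comap (graphPerm n)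

/-- The star transpositions, exchanging the last vertex with another vertex. -/
def starTranspositions (n : ℕ) : Finset (Equiv.Perm (Fin n)) :=
  Finset.univ.filter fun σ => ∃ i j : Fin n, i ≠ j ∧ j.val + 1 = n ∧ σ = Equiv.swap i j

/-! Everything rests on the spectrum of the star transpositions. Their sum is a Jucys–Murphy
element, and such an element has integer eigenvalues in every finite-dimensional complex
representation (`exists_int_eq_of_hasEigenvalue_sum_swap`). Hence the Cayley Laplacian, which is `n
- 1` minus this sum in the regular representation, has integer eigenvalues. It is positive
semidefinite and, as the generators connect the group, only constants lie in its kernel. So every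
other eigenvalue is at least `1`; for `n ≥ 3` an explicit eigenfunction attains `1`.

One step of the walk is `I - L / n`. The spectrum of `L` off the constants lies in `[1, 2(n - 1)]`,
so a step contracts mean-zero functions in `ℓ²` by `1 - 1/n ≤ exp (-1/n)` (`sum_sq_starWalk_le`).
Both states are mixtures of relabelled basis projectors, hence diagonal, and a channel acts on the
mixing weights by convolution (`groupChannel_relabelledState`). A diagonal entry at `y` in the orbit
sums the weights over a coset of the stabilizer, so Cauchy–Schwarz turns the `ℓ²` bound into the
factor `√|H(x)|`.

For circuits, the vertex transposition `(p q)` acts on edges by exchanging `{p,k}` with `{q,k}` for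
each of the `n - 2` other vertices `k` (`exists_edge_swaps`). Each exchange is three CNOT gates, or
at most `2N - 3` neighbouring swaps. -/

/-! ### Integrality of the Jucys–Murphy spectrum -/

/-- The eigenvalues of a sum of transpositions `(t a)`, `t ∈ T`, in a representation of the
symmetric group are integers. -/
theorem exists_int_eq_of_hasEigenvalue_sum_swap {α V : Type*} [DecidableEq α] [AddCommGroup V]
    [Module ℂ V] [FiniteDimensional ℂ V] (ρ : Equiv.Perm α →* Module.End ℂ V) (T : Finset α) :
    ∀ a ∉ T, ∀ μ : ℂ, Module.End.HasEigenvalue (∑ t ∈ T, ρ (Equiv.swap t a)) μ →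
      ∃ k : ℤ, μ = k := by
  induction T using Finset.induction_on with
  | empty =>
    intro a _ μ hμ
    obtain ⟨v, hv⟩ := hμ.exists_hasEigenvector
    have h := hv.apply_eq_smul
    simp only [Finset.sum_empty, LinearMap.zero_apply] at h
    exact ⟨0, by simpa using (smul_eq_zero.mp h.symm).resolve_right hv.2⟩
  | insert c T hc ih =>
    intro a ha b hb
    have hac : a ≠ c := fun h => ha (h ▸ Finset.mem_insert_self _ _)
    have haT : a ∉ T := fun h => ha (Finset.mem_insert_of_mem h)
    set X : Module.End ℂ V := ∑ t ∈ T, ρ (Equiv.swap t c) with hX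
    set Y : Module.End ℂ V := ∑ t ∈ insert c T, ρ (Equiv.swap t a) with hY
    set s : Module.End ℂ V := ρ (Equiv.swap c a) with hs
    have hss : s * s = 1 := by rw [hs, ← map_mul, Equiv.swap_mul_self, map_one]
    -- Conjugation by `(c a)` carries `(t c)` to `(t a)` for `t ∈ T`; the extra summand `t = c` is
    -- `s` itself.
    have hYX : Y = s * X * s + s := by
      rw [hY, hX, Finset.sum_insert hc, add_comm, Finset.mul_sum, Finset.sum_mul]
      congr 1
      refine Finset.sum_congr rfl fun t ht => ?_
      rw [hs, ← map_mul, ← map_mul]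
      congr 1
      have htc : t ≠ c := fun h => hc (h ▸ ht)
      have hta : t ≠ a := fun h => haT (h ▸ ht)
      have := Equiv.swap_apply_apply (Equiv.swap c a) t c
      rw [Equiv.swap_apply_of_ne_of_ne htc hta, Equiv.swap_apply_left, Equiv.swap_inv] at this
      exact this
    -- Each `(u c)` with `u ∈ T` fixes `a` and preserves `insert c T`, so conjugation by it only
    -- permutes the summands of `Y`.
    have hcomm : Commute X Y := by
      refine Commute.sum_left _ _ _ fun u hu => ?_
      have huc : u ≠ c := fun h => hc (h ▸ hu)
      have hua : u ≠ a := fun h => haT (h ▸ hu)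
      set π := Equiv.swap u c
      have hπa : π a = a := Equiv.swap_apply_of_ne_of_ne hua.symm hac
      have hπT : ∀ t, t ∈ insert c T → π t ∈ insert c T := by
        intro t ht
        by_cases h1 : t = u
        · rw [h1, Equiv.swap_apply_left]; exact Finset.mem_insert_self _ _
        by_cases h2 : t = c
        · rw [h2, Equiv.swap_apply_right]; exact Finset.mem_insert_of_mem hu
        rwa [Equiv.swap_apply_of_ne_of_ne h1 h2]
      change ρ π * Y = Y * ρ π
      rw [hY, Finset.mul_sum, Finset.sum_mul]
      refine Finset.sum_bij' (fun t _ => π t) (fun t _ => π t) hπT hπT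
        (fun t _ => Equiv.swap_apply_self _ _ _)
        (fun t _ => Equiv.swap_apply_self _ _ _) fun t _ => ?_
      rw [← map_mul, ← map_mul]
      congr 1
      have := Equiv.swap_apply_apply π t a
      rw [hπa] at this
      rw [this, inv_mul_cancel_right]
    -- Since `X` preserves the `b`-eigenspace of `Y`, the two share an eigenvector `v`; its
    -- `X`-eigenvalue `e` is an integer by induction.
    have hmaps := Module.End.mapsTo_genEigenspace_of_comm hcomm.symm b 1
    have : Nontrivial (Module.End.genEigenspace Y b 1) :=
      Submodule.nontrivial_iff_ne_bot.mpr hb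
    obtain ⟨e, he⟩ := Module.End.exists_eigenvalue (X.restrict hmaps)
    obtain ⟨v, hv⟩ := he.exists_hasEigenvector
    have hv0 : (v : V) ≠ 0 := fun h => hv.2 (Subtype.ext h)
    have hXv : X v = e • (v : V) := congrArg Subtype.val hv.apply_eq_smul
    have hYv : Y v = b • (v : V) := Module.End.mem_eigenspace_iff.mp v.2
    obtain ⟨k, hk⟩ := ih c hc e
      (Module.End.hasEigenvalue_of_hasEigenvector ⟨Module.End.mem_eigenspace_iff.mpr hXv, hv0⟩)
    have hssv : ∀ w, s (s w) = w := fun w => LinearMap.congr_fun hss w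
    have hXs : X (s v) = b • s v - v := by
      have h0 : ∀ w, s (Y w) = X (s w) + w := fun w => by
        rw [hYX]; simp [hssv]
      have h1 := h0 v
      rw [hYv, map_smul] at h1
      rw [h1]; abel
    -- From `X (s v) = b • s v - v`, the vector `(b - e) • s v - v` satisfies the eigenvector
    -- equation of `X` for `b`. If it is nonzero, induction applies to `b`. If it vanishes, `s² = 1`
    -- forces `(b - e)² = 1`, so `b = e ± 1`.
    by_cases hu : (b - e) • s (v : V) - v = 0
    · have h1 : (b - e) • s (v : V) = v := sub_eq_zero.mp hu
      have h2 : (b - e) • (v : V) = s v := by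
        have := congrArg s h1
        rwa [map_smul, hssv] at this
      rw [← h2, smul_smul] at h1
      have h3 : ((b - e) * (b - e) - 1) • (v : V) = 0 := by rw [sub_smul, h1, one_smul, sub_self]
      have h4 := (smul_eq_zero.mp h3).resolve_right hv0
      have h5 : (b - e - 1) * (b - e + 1) = 0 := by linear_combination h4
      rcases mul_eq_zero.mp h5 with h | h
      · exact ⟨k + 1, by push_cast; linear_combination h + hk⟩
      · exact ⟨k - 1, by push_cast; linear_combination h + hk⟩
    · refine ih c hc b (Module.End.hasEigenvalue_of_hasEigenvector
        ⟨Module.End.mem_eigenspace_iff.mpr ?_, hu⟩)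
      change X _ = _
      rw [map_sub, map_smul, hXs, hXv]
      module

/-! ### The Cayley graph of the star transpositions -/

theorem starTranspositions_eq_image {n : ℕ} {z : Fin n} (hz : z.val + 1 = n) :
    starTranspositions n = (Finset.univ.erase z).image fun t => Equiv.swap t z := by
  ext σ
  simp only [starTranspositions, Finset.mem_filter, Finset.mem_univ, true_and, Finset.mem_image,
    Finset.mem_erase, and_true]
  constructor
  · rintro ⟨i, j, hij, hj, rfl⟩
    have : j = z := Fin.ext (by omega)
    subst this
    exact ⟨i, hij, rfl⟩
  · rintro ⟨t, ht, rfl⟩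
    exact ⟨t, z, ht, hz, rfl⟩

theorem swap_left_injective {α : Type*} [DecidableEq α] (z : α) :
    Function.Injective fun t => Equiv.swap t z := by
  intro s t h
  have := congrArg (fun σ : Equiv.Perm α => σ z) h
  simpa using this

theorem sum_starTranspositions {n : ℕ} {z : Fin n} (hz : z.val + 1 = n) {M : Type*}
    [AddCommMonoid M] (F : Equiv.Perm (Fin n) → M) :
    ∑ h ∈ starTranspositions n, F h = ∑ t ∈ Finset.univ.erase z, F (Equiv.swap t z) := by
  rw [starTranspositions_eq_image hz, Finset.sum_image fun _ _ _ _ h => swap_left_injective z h]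

theorem card_starTranspositions (n : ℕ) : (starTranspositions n).card = n - 1 := by
  rcases n with _ | m
  · rfl
  · rw [starTranspositions_eq_image (z := Fin.last m) rfl,
      Finset.card_image_of_injective _ (swap_left_injective _), Finset.card_erase_of_mem
      (Finset.mem_univ _), Finset.card_univ, Fintype.card_fin]

theorem inv_eq_self_of_mem_starTranspositions {n : ℕ} {σ : Equiv.Perm (Fin n)}
    (h : σ ∈ starTranspositions n) : σ⁻¹ = σ := by
  simp only [starTranspositions, Finset.mem_filter, Finset.mem_univ, true_and] at h
  obtain ⟨i, j, -, -, rfl⟩ := h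
  exact Equiv.swap_inv i j

theorem mem_starTranspositions_iff_inv_mem {n : ℕ} (σ : Equiv.Perm (Fin n)) :
    σ ∈ starTranspositions n ↔ σ⁻¹ ∈ starTranspositions n := by
  constructor <;> intro h
  · rwa [inv_eq_self_of_mem_starTranspositions h]
  · have := inv_eq_self_of_mem_starTranspositions h
    rw [inv_inv] at this
    rwa [this]

theorem one_notMem_starTranspositions (n : ℕ) : 1 ∉ starTranspositions n := by
  intro h
  simp only [starTranspositions, Finset.mem_filter, Finset.mem_univ, true_and] at h
  obtain ⟨i, j, hij, -, h⟩ := h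
  exact hij (by simpa using congrArg (fun σ : Equiv.Perm (Fin n) => σ j) h.symm)

theorem closure_starTranspositions (n : ℕ) :
    Subgroup.closure (starTranspositions n : Set (Equiv.Perm (Fin n))) = ⊤ := by
  rcases n with _ | m
  · exact Subsingleton.elim _ _
  rw [eq_top_iff, ← Equiv.Perm.closure_isSwap, Subgroup.closure_le]
  have key : ∀ i : Fin (m + 1), Equiv.swap i (Fin.last m) ∈
      Subgroup.closure (starTranspositions (m + 1) : Set (Equiv.Perm (Fin (m + 1)))) := by
    intro i
    by_cases hi : i = Fin.last m
    · rw [hi, Equiv.swap_self]; exact one_mem _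
    · refine Subgroup.subset_closure ?_
      rw [Finset.mem_coe, starTranspositions_eq_image (z := Fin.last m) rfl]
      exact Finset.mem_image.mpr ⟨i, Finset.mem_erase.mpr ⟨hi, Finset.mem_univ _⟩, rfl⟩
  rintro _ ⟨i, j, hij, rfl⟩
  by_cases hi : i = Fin.last m
  · rw [hi, Equiv.swap_comm]; exact key j
  by_cases hj : j = Fin.last m
  · rw [hj]; exact key i
  -- With `z` the last vertex, `(i j) = (j z)(i z)(j z)`.
  have := Equiv.swap_apply_apply (Equiv.swap j (Fin.last m)) i (Fin.last m)
  rw [Equiv.swap_apply_of_ne_of_ne hij hi, Equiv.swap_apply_right] at this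
  rw [SetLike.mem_coe, this]
  exact mul_mem (mul_mem (key j) (key i)) (inv_mem (key j))

theorem leftCayleyGraph_adj_iff {G : Type*} [Group G] {S : Finset G} (h1 : 1 ∉ S)
    (hS : ∀ g, g ∈ S ↔ g⁻¹ ∈ S) (g k : G) :
    (leftCayleyGraph S).Adj g k ↔ k * g⁻¹ ∈ S := by
  rw [leftCayleyGraph, SimpleGraph.fromRel_adj]
  constructor
  · rintro ⟨-, ⟨h, hh, rfl⟩ | ⟨h, hh, rfl⟩⟩
    · simpa using hh
    · rw [hS]; simpa using hh
  · intro h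
    refine ⟨?_, Or.inl ⟨_, h, by simp⟩⟩
    rintro rfl
    exact h1 (by simpa using h)

open Classical in
/-- The Laplacian matrix of the Cayley graph. -/
noncomputable def cayleyLaplacian {G : Type*} [Group G] [Fintype G] (S : Finset G) :
    Matrix G G ℝ :=
  (leftCayleyGraph S).lapMatrix ℝ

open Classical in
theorem cayleyLaplacian_mulVec {G : Type*} [Group G] [Fintype G] {S : Finset G}
    (h1 : 1 ∉ S) (hS : ∀ g, g ∈ S ↔ g⁻¹ ∈ S) (f : G → ℝ) (g : G) :
    (cayleyLaplacian S *ᵥ f) g = S.card * f g - ∑ h ∈ S, f (h * g) := by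
  have hN : (leftCayleyGraph S).neighborFinset g = S.image (· * g) := by
    ext k
    rw [SimpleGraph.mem_neighborFinset, leftCayleyGraph_adj_iff h1 hS, Finset.mem_image]
    constructor
    · exact fun h => ⟨_, h, by simp⟩
    · rintro ⟨h, hh, rfl⟩
      simpa using hh
  rw [cayleyLaplacian, SimpleGraph.lapMatrix_mulVec_apply, ← SimpleGraph.card_neighborFinset_eq_degree, hN,
    Finset.card_image_of_injective _ (mul_left_injective g),
    Finset.sum_image fun _ _ _ _ h => mul_left_injective g h]

open Classical in
theorem eq_of_cayleyLaplacian_mulVec_eq_zero {G : Type*} [Group G] [Fintype G]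
    {S : Finset G} (h1 : 1 ∉ S) (hS : ∀ g, g ∈ S ↔ g⁻¹ ∈ S)
    (htop : Subgroup.closure (S : Set G) = ⊤) {f : G → ℝ}
    (hf : cayleyLaplacian S *ᵥ f = 0) (g : G) : f g = f 1 := by
  rw [cayleyLaplacian, SimpleGraph.lapMatrix_mulVec_eq_zero_iff_forall_adj] at hf
  have hg : g ∈ Subgroup.closure (S : Set G) := htop ▸ Subgroup.mem_top g
  have step : ∀ x ∈ S, ∀ y, f (x * y) = f y := fun x hx y =>
    (hf y (x * y) ((leftCayleyGraph_adj_iff h1 hS _ _).mpr (by simpa using hx))).symm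
  induction hg using Subgroup.closure_induction_left with
  | one => rfl
  | mul_left x hx y _ ih => rw [step x hx, ih]
  | inv_mul_cancel x hx y _ ih => rw [step x⁻¹ ((hS x).mp hx), ih]

/-- The Laplacian of the Cayley graph of the star transpositions has integral eigenvalues. -/
theorem exists_int_eq_of_cayleyLaplacian_mulVec_eq_smul {n : ℕ} (hn : 1 ≤ n)
    {f : Equiv.Perm (Fin n) → ℝ} (hf : f ≠ 0) {a : ℝ}
    (h : cayleyLaplacian (starTranspositions n) *ᵥ f = a • f) :
    ∃ k : ℤ, a = k := by
  obtain ⟨z, hz⟩ : ∃ z : Fin n, z.val + 1 = n := ⟨⟨n - 1, by omega⟩, Nat.sub_add_cancel hn⟩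
  -- The regular representation is taken over `ℂ` because the integrality argument needs common
  -- eigenvectors to exist. The inverse in the translation is harmless: transpositions are
  -- involutions.
  let ρ : Equiv.Perm (Fin n) →* Module.End ℂ (Equiv.Perm (Fin n) → ℂ) :=
    { toFun := fun g => LinearMap.funLeft ℂ ℂ fun x => g⁻¹ * x
      map_one' := by ext; simp [LinearMap.funLeft]
      map_mul' := fun g k => by
        refine LinearMap.ext fun f => funext fun x => ?_
        simp [LinearMap.funLeft_apply, mul_assoc] }
  have hρ : ∀ g f x, ρ g f x = f (g⁻¹ * x) := fun _ _ _ => rfl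
  have hF : (∑ t ∈ Finset.univ.erase z, ρ (Equiv.swap t z)) (fun g => (f g : ℂ)) =
      (((n - 1 : ℕ) - a : ℝ) : ℂ) • fun g => (f g : ℂ) := by
    funext g
    have := congrFun h g
    rw [cayleyLaplacian_mulVec (one_notMem_starTranspositions n)
      mem_starTranspositions_iff_inv_mem, sum_starTranspositions hz, card_starTranspositions,
      Pi.smul_apply, smul_eq_mul] at this
    have h2 : ∑ t ∈ Finset.univ.erase z, f (Equiv.swap t z * g) = ((n - 1 : ℕ) - a : ℝ) * f g := by
      linarith
    rw [LinearMap.sum_apply, Finset.sum_apply]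
    simp only [hρ, Equiv.swap_inv, Pi.smul_apply, smul_eq_mul]
    exact_mod_cast h2
  obtain ⟨k, hk⟩ := exists_int_eq_of_hasEigenvalue_sum_swap ρ (Finset.univ.erase z) z
    (Finset.notMem_erase _ _) _ (Module.End.hasEigenvalue_of_hasEigenvector
      ⟨Module.End.mem_eigenspace_iff.mpr hF, fun h0 =>
        hf (funext fun g => by simpa using congrFun h0 g)⟩)
  refine ⟨(n - 1 : ℕ) - k, ?_⟩
  have : ((n - 1 : ℕ) - a : ℝ) = k := by exact_mod_cast hk
  push_cast
  linarith

/-- Compare both sides of the eigenvalue equation at a point where `|f|` is maximal. -/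
theorem eigenvalue_le_of_cayleyLaplacian_mulVec_eq_smul {G : Type*} [Group G] [Fintype G]
    {S : Finset G} (h1 : 1 ∉ S) (hS : ∀ g, g ∈ S ↔ g⁻¹ ∈ S) {f : G → ℝ} (hf : f ≠ 0) {a : ℝ}
    (h : cayleyLaplacian S *ᵥ f = a • f) : a ≤ 2 * S.card := by
  obtain ⟨g, hg⟩ := Finite.exists_max fun g => |f g|
  have hpos : 0 < |f g| := by
    obtain ⟨k, hk⟩ := Function.ne_iff.mp hf
    exact (abs_pos.mpr hk).trans_le (hg k)
  have h2 := congrFun h g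
  rw [cayleyLaplacian_mulVec h1 hS, Pi.smul_apply, smul_eq_mul] at h2
  have h3 : |∑ h ∈ S, f (h * g)| ≤ S.card * |f g| := by
    refine (Finset.abs_sum_le_sum_abs _ _).trans ?_
    rw [← nsmul_eq_mul]
    exact Finset.sum_le_card_nsmul _ _ _ fun h _ => hg _
  have h4 : (a - S.card) * f g = -∑ h ∈ S, f (h * g) := by linarith
  have h5 : |a - S.card| * |f g| ≤ S.card * |f g| := by rw [← abs_mul, h4, abs_neg]; exact h3
  have h6 := (le_abs_self _).trans (le_of_mul_le_mul_right h5 hpos)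
  linarith

/-! ### The spectral gap -/

theorem Matrix.IsHermitian.eigenvectorBasis_dotProduct_mulVec {n : Type*} [Fintype n]
    [DecidableEq n] {A : Matrix n n ℝ} (hA : A.IsHermitian) (i : n) (f : n → ℝ) :
    (hA.eigenvectorBasis i : n → ℝ) ⬝ᵥ (A *ᵥ f) =
      hA.eigenvalues i * ((hA.eigenvectorBasis i : n → ℝ) ⬝ᵥ f) := by
  have hT : Aᵀ = A := by simpa [Matrix.IsHermitian] using hA
  have h := hA.mulVec_eigenvectorBasis i
  rw [Matrix.dotProduct_mulVec, ← Matrix.mulVec_transpose, hT, h, smul_dotProduct, smul_eq_mul]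

theorem Matrix.IsHermitian.sum_sq_eigenvectorBasis_dotProduct {n : Type*} [Fintype n]
    [DecidableEq n] {A : Matrix n n ℝ} (hA : A.IsHermitian) (f : n → ℝ) :
    ∑ i, ((hA.eigenvectorBasis i : n → ℝ) ⬝ᵥ f) ^ 2 = ∑ j, f j ^ 2 := by
  have h := hA.eigenvectorBasis.sum_sq_norm_inner_right (WithLp.toLp 2 f)
  rw [EuclideanSpace.norm_sq_eq] at h
  simpa [EuclideanSpace.inner_eq_star_dotProduct, dotProduct_comm] using h

/-- Otherwise `f` would be orthogonal to the whole eigenvector basis, and Parseval would give `f =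
0`. -/
theorem Matrix.IsHermitian.exists_eigenvalues_eq {n : Type*} [Fintype n] [DecidableEq n]
    {A : Matrix n n ℝ} (hA : A.IsHermitian) {f : n → ℝ} (hf : f ≠ 0) {a : ℝ}
    (h : A *ᵥ f = a • f) : ∃ i, hA.eigenvalues i = a := by
  by_contra! hne
  have h0 : ∀ i, (hA.eigenvectorBasis i : n → ℝ) ⬝ᵥ f = 0 := by
    intro i
    have h1 := hA.eigenvectorBasis_dotProduct_mulVec i f
    rw [h, dotProduct_smul, smul_eq_mul] at h1
    exact (mul_eq_mul_right_iff.mp h1).resolve_left (hne i).symm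
  have h2 := hA.sum_sq_eigenvectorBasis_dotProduct f
  simp only [h0, ne_eq, OfNat.ofNat_ne_zero, not_false_eq_true, zero_pow,
    Finset.sum_const_zero] at h2
  refine hf (funext fun j => ?_)
  have := (Finset.sum_eq_zero_iff_of_nonneg fun i _ => sq_nonneg (f i)).mp h2.symm j
    (Finset.mem_univ j)
  simpa using this

theorem Matrix.IsHermitian.eigenvectorBasis_ne_zero {n : Type*} [Fintype n]
    [DecidableEq n] {A : Matrix n n ℝ} (hA : A.IsHermitian) (i : n) :
    (hA.eigenvectorBasis i : n → ℝ) ≠ 0 := by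
  intro h
  refine hA.eigenvectorBasis.orthonormal.ne_zero i ?_
  ext j
  exact congrFun h j

open Classical in
theorem posSemidef_cayleyLaplacian {G : Type*} [Group G] [Fintype G] (S : Finset G) :
    (cayleyLaplacian S).PosSemidef :=
  SimpleGraph.posSemidef_lapMatrix ℝ _

theorem one_le_laplacian_eigenvalue {n : ℕ} (hn : 1 ≤ n) {f : Equiv.Perm (Fin n) → ℝ}
    (hf : f ≠ 0) {a : ℝ}
    (h : cayleyLaplacian (starTranspositions n) *ᵥ f = a • f) (ha : a ≠ 0) :
    1 ≤ a := by
  have hnn : 0 ≤ a := by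
    have h1 := (posSemidef_cayleyLaplacian (starTranspositions n)).dotProduct_mulVec_nonneg f
    rw [h, star_trivial, dotProduct_smul, smul_eq_mul] at h1
    have h2 : 0 < f ⬝ᵥ f := by
      rw [← star_trivial f]
      exact Matrix.dotProduct_star_self_pos_iff.mpr hf
    exact nonneg_of_mul_nonneg_left h1 h2
  obtain ⟨k, rfl⟩ := exists_int_eq_of_cayleyLaplacian_mulVec_eq_smul hn hf h
  have h3 : 0 < k := lt_of_le_of_ne (by exact_mod_cast hnn) (by exact_mod_cast ha.symm)
  exact_mod_cast h3

theorem laplacian_dotProduct_eq_zero {n : ℕ} {v f : Equiv.Perm (Fin n) → ℝ}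
    (hv : cayleyLaplacian (starTranspositions n) *ᵥ v = 0) (hf : ∑ g, f g = 0) :
    v ⬝ᵥ f = 0 := by
  have h := eq_of_cayleyLaplacian_mulVec_eq_zero (one_notMem_starTranspositions n)
    mem_starTranspositions_iff_inv_mem (closure_starTranspositions n) hv
  simp only [dotProduct]
  rw [Finset.sum_congr rfl fun g _ => by rw [h g], ← Finset.mul_sum, hf, mul_zero]

-- If the second smallest eigenvalue were `0`, so would be the smallest, because a nonzero
-- eigenvalue is at least `c > 0`. Two orthogonal eigenvectors would then both be nonzero constants,
-- which is impossible.
open Classical in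
theorem le_laplacianGap {G : Type*} [Group G] [Fintype G] {S : Finset G} (h1 : 1 ∉ S)
    (hS : ∀ g, g ∈ S ↔ g⁻¹ ∈ S) (htop : Subgroup.closure (S : Set G) = ⊤)
    (hcard : 1 < Fintype.card G) {c : ℝ} (hc : 0 < c)
    (hgap : ∀ f : G → ℝ, f ≠ 0 → ∀ a : ℝ, cayleyLaplacian S *ᵥ f = a • f → a ≠ 0 → c ≤ a) :
    c ≤ laplacianGap S := by
  rw [laplacianGap, dif_pos hcard]
  set hA := (leftCayleyGraph S).isHermitian_lapMatrix ℝ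
  let e := Fintype.equivOfCardEq (Fintype.card_fin (Fintype.card G))
  have he : ∀ k, hA.eigenvalues₀ k = hA.eigenvalues (e k) := fun k => by
    rw [Matrix.IsHermitian.eigenvalues, Equiv.symm_apply_apply]
  rw [he]
  refine hgap _ (hA.eigenvectorBasis_ne_zero _) _ (hA.mulVec_eigenvectorBasis _) fun h0 => ?_
  set i₁ := e (Fin.rev ⟨1, hcard⟩) with hi₁
  set i₀ := e (Fin.rev ⟨0, by omega⟩) with hi₀
  have hne : i₀ ≠ i₁ := by
    rw [hi₀, hi₁]
    simp [Fin.ext_iff]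
    omega
  have hle : hA.eigenvalues i₀ ≤ 0 := by
    rw [← h0, hi₀, hi₁, ← he, ← he]
    refine hA.eigenvalues₀_antitone ?_
    rw [Fin.rev_le_rev]
    exact Fin.mk_le_mk.mpr (by omega)
  have h00 : hA.eigenvalues i₀ = 0 := by
    by_contra hne0
    linarith [hgap _ (hA.eigenvectorBasis_ne_zero i₀) _ (hA.mulVec_eigenvectorBasis i₀) hne0]
  have hconst : ∀ i, hA.eigenvalues i = 0 → ∀ g,
      hA.eigenvectorBasis i g = hA.eigenvectorBasis i 1 := by
    intro i hi
    refine eq_of_cayleyLaplacian_mulVec_eq_zero h1 hS htop ?_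
    rw [cayleyLaplacian, hA.mulVec_eigenvectorBasis, hi, zero_smul]
  have horth : inner ℝ (hA.eigenvectorBasis i₀) (hA.eigenvectorBasis i₁) = 0 :=
    hA.eigenvectorBasis.orthonormal.2 hne
  rw [EuclideanSpace.inner_eq_star_dotProduct] at horth
  simp only [star_trivial, dotProduct] at horth
  rw [Finset.sum_congr rfl fun g _ => by rw [hconst i₁ h0 g, hconst i₀ h00 g], Finset.sum_const,
    nsmul_eq_mul] at horth
  have hc0 : ((Finset.univ : Finset G).card : ℝ) ≠ 0 := by
    rw [Finset.card_univ]; exact_mod_cast (by omega)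
  have hz : ∀ i, hA.eigenvalues i = 0 → hA.eigenvectorBasis i 1 ≠ 0 := fun i hi h1 =>
    hA.eigenvectorBasis_ne_zero i (funext fun g => by rw [hconst i hi g, h1]; rfl)
  exact mul_ne_zero hc0 (mul_ne_zero (hz i₁ h0) (hz i₀ h00)) horth

-- Both `a > 0` and the eigenvalue `0` of the constants occur in the list, so `a` is not in its last
-- place and bounds the last but one from above.
open Classical in
theorem laplacianGap_le {G : Type*} [Group G] [Fintype G] {S : Finset G} {f : G → ℝ} (hf0 : f ≠ 0)
    {a : ℝ} (ha : 0 < a) (hf : cayleyLaplacian S *ᵥ f = a • f) : laplacianGap S ≤ a := by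
  rw [laplacianGap]
  split_ifs with hcard
  swap
  · exact ha.le
  set hA := (leftCayleyGraph S).isHermitian_lapMatrix ℝ
  let e := Fintype.equivOfCardEq (Fintype.card_fin (Fintype.card G))
  have he : ∀ k, hA.eigenvalues₀ k = hA.eigenvalues (e k) := fun k => by
    rw [Matrix.IsHermitian.eigenvalues, Equiv.symm_apply_apply]
  obtain ⟨i, hi⟩ := hA.exists_eigenvalues_eq hf0 hf
  have hone : (fun _ => 1 : G → ℝ) ≠ 0 := fun h => one_ne_zero (congrFun h 1)
  obtain ⟨j, hj⟩ := hA.exists_eigenvalues_eq (a := 0) hone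
    (by rw [zero_smul]; exact SimpleGraph.lapMatrix_mulVec_const_eq_zero _)
  rw [← e.apply_symm_apply i, ← he] at hi
  rw [← e.apply_symm_apply j, ← he] at hj
  have hlt : e.symm i < e.symm j := by
    by_contra! hc
    linarith [hA.eigenvalues₀_antitone hc]
  rw [← hi]
  refine hA.eigenvalues₀_antitone ?_
  rw [Fin.le_iff_val_le_val, Fin.val_rev]
  have := (e.symm j).isLt
  have := Fin.lt_def.mp hlt
  simp only
  omega

theorem one_le_laplacianGap {n : ℕ} (hn : 2 ≤ n) : 1 ≤ laplacianGap (starTranspositions n) := by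
  refine le_laplacianGap (one_notMem_starTranspositions n) mem_starTranspositions_iff_inv_mem
    (closure_starTranspositions n) ?_ one_pos fun f hf a h ha =>
      one_le_laplacian_eigenvalue (by omega) hf h ha
  rw [Fintype.card_perm, Fintype.card_fin]
  exact Nat.one_lt_factorial.mpr hn

theorem laplacianGap_starTranspositions {n : ℕ} (hn : 3 ≤ n) :
    laplacianGap (starTranspositions n) = 1 := by
  refine le_antisymm ?_ (one_le_laplacianGap (by omega))
  obtain ⟨z, hz⟩ : ∃ z : Fin n, z.val + 1 = n := ⟨⟨n - 1, by omega⟩, by simp; omega⟩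
  obtain ⟨p, q, hpq, hpz, hqz⟩ : ∃ p q : Fin n, p ≠ q ∧ p ≠ z ∧ q ≠ z :=
    ⟨⟨0, by omega⟩, ⟨1, by omega⟩, by simp, by simp [Fin.ext_iff]; omega,
      by simp [Fin.ext_iff]; omega⟩
  -- A function of `g p` alone sees only the walk of one vertex. There, any `φ` with zero sum and `φ
  -- z = 0` has eigenvalue `1`; avoiding `z` needs two further vertices, hence `n ≥ 3`.
  let φ : Fin n → ℝ := Pi.single p 1 - Pi.single q 1
  have hφz : φ z = 0 := by simp [φ, hpz.symm, hqz.symm]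
  have hφsum : ∑ i, φ i = 0 := by simp [φ]
  let f : Equiv.Perm (Fin n) → ℝ := fun g => φ (g p)
  have hf0 : f ≠ 0 := fun h => by
    have := congrFun h 1
    simp [f, φ, hpq] at this
  have hf : cayleyLaplacian (starTranspositions n) *ᵥ f = (1 : ℝ) • f := by
    funext g
    rw [cayleyLaplacian_mulVec (one_notMem_starTranspositions n)
      mem_starTranspositions_iff_inv_mem, sum_starTranspositions hz, card_starTranspositions,
      one_smul]
    simp only [f, Equiv.Perm.mul_apply]
    have hcast : ((n - 1 : ℕ) : ℝ) = n - 1 := by push_cast [Nat.cast_sub (by omega : 1 ≤ n)]; ring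
    by_cases hg : g p = z
    · rw [hg, hφz, mul_zero]
      simp only [Equiv.swap_apply_right]
      have h0 := Finset.add_sum_erase _ φ (Finset.mem_univ z)
      rw [hφz, hφsum, zero_add] at h0
      rw [h0, sub_zero]
    · rw [← Finset.add_sum_erase _ _ (Finset.mem_erase.mpr ⟨hg, Finset.mem_univ (g p)⟩),
        Equiv.swap_apply_left, hφz, zero_add]
      rw [Finset.sum_congr rfl (g := fun _ => φ (g p)) fun t ht => by
        rw [Equiv.swap_apply_of_ne_of_ne (Finset.ne_of_mem_erase ht).symm hg]]
      rw [Finset.sum_const, Finset.card_erase_of_mem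
        (Finset.mem_erase.mpr ⟨hg, Finset.mem_univ _⟩), Finset.card_erase_of_mem
        (Finset.mem_univ _), Finset.card_univ, Fintype.card_fin, nsmul_eq_mul]
      push_cast [Nat.cast_sub (by omega : 1 ≤ n - 1), Nat.cast_sub (by omega : 1 ≤ n)]
      ring
  exact laplacianGap_le hf0 one_pos hf

/-! ### Mean-square convergence of the walk -/

/-- One step of the random walk generated by the star transpositions and the identity. -/
noncomputable def starWalk {n : ℕ} (f : Equiv.Perm (Fin n) → ℝ) (g : Equiv.Perm (Fin n)) : ℝ :=
  1 / n * (f g + ∑ h ∈ starTranspositions n, f (h * g))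

theorem sum_starWalk {n : ℕ} (hn : 1 ≤ n) (f : Equiv.Perm (Fin n) → ℝ) :
    ∑ g, starWalk f g = ∑ g, f g := by
  have hn0 : (n : ℝ) ≠ 0 := by exact_mod_cast (by omega : n ≠ 0)
  simp only [starWalk]
  rw [← Finset.mul_sum, Finset.sum_add_distrib, Finset.sum_comm]
  have h : ∀ h, ∑ g, f (h * g) = ∑ g, f g := fun h => Equiv.sum_comp (Equiv.mulLeft h) f
  simp only [h]
  rw [Finset.sum_const, card_starTranspositions, nsmul_eq_mul, Nat.cast_sub hn]
  field_simp
  push_cast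
  ring

theorem starWalk_eq {n : ℕ} (hn : 1 ≤ n) (f : Equiv.Perm (Fin n) → ℝ) :
    starWalk f = f - (1 / n : ℝ) •
      (cayleyLaplacian (starTranspositions n) *ᵥ f) := by
  have hn0 : (n : ℝ) ≠ 0 := by exact_mod_cast (by omega : n ≠ 0)
  funext g
  rw [Pi.sub_apply, Pi.smul_apply, cayleyLaplacian_mulVec
    (one_notMem_starTranspositions n) mem_starTranspositions_iff_inv_mem, card_starTranspositions,
    Nat.cast_sub hn, starWalk, smul_eq_mul]
  field_simp
  push_cast
  ring

/-- In an eigenbasis of the Laplacian the step multiplies a coordinate by `1 - λ/n`. Coordinates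
with `λ = 0` vanish for mean-zero `f`; the others have `1 ≤ λ ≤ 2(n - 1)`. -/
theorem sum_sq_starWalk_le {n : ℕ} (hn : 1 ≤ n) {f : Equiv.Perm (Fin n) → ℝ}
    (hf : ∑ g, f g = 0) :
    ∑ g, starWalk f g ^ 2 ≤ (1 - 1 / n : ℝ) ^ 2 * ∑ g, f g ^ 2 := by
  have hn1 : (1 : ℝ) ≤ n := by exact_mod_cast hn
  have hA := (posSemidef_cayleyLaplacian (starTranspositions n)).isHermitian
  rw [← hA.sum_sq_eigenvectorBasis_dotProduct, ← hA.sum_sq_eigenvectorBasis_dotProduct f,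
    Finset.mul_sum]
  refine Finset.sum_le_sum fun i _ => ?_
  rw [starWalk_eq hn, dotProduct_sub, dotProduct_smul, hA.eigenvectorBasis_dotProduct_mulVec,
    smul_eq_mul]
  by_cases h0 : hA.eigenvalues i = 0
  · rw [laplacian_dotProduct_eq_zero (by rw [hA.mulVec_eigenvectorBasis, h0, zero_smul]) hf]
    simp
  have h1 := one_le_laplacian_eigenvalue hn (hA.eigenvectorBasis_ne_zero i)
    (hA.mulVec_eigenvectorBasis i) h0
  have h2 := eigenvalue_le_of_cayleyLaplacian_mulVec_eq_smul (one_notMem_starTranspositions n)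
    mem_starTranspositions_iff_inv_mem (hA.eigenvectorBasis_ne_zero i)
    (hA.mulVec_eigenvectorBasis i)
  rw [card_starTranspositions, Nat.cast_sub hn, Nat.cast_one] at h2
  set c := (hA.eigenvectorBasis i : _ → ℝ) ⬝ᵥ f
  have h3 : c - 1 / n * (hA.eigenvalues i * c) = (1 - hA.eigenvalues i / n) * c := by ring
  rw [h3, mul_pow]
  refine mul_le_mul_of_nonneg_right (sq_le_sq' ?_ ?_) (sq_nonneg _)
  -- The lower end is `1 - 2(n - 1)/n = -1 + 2/n ≥ -(1 - 1/n)`; including the identity in the walk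
  -- provides this slack.
  · have : hA.eigenvalues i / n ≤ (2 * (n - 1)) / n := by gcongr
    have h4 : (2 * (n - 1) : ℝ) / n = 2 - 2 * (1 / n) := by field_simp
    have h5 : (0 : ℝ) ≤ 1 / n := by positivity
    linarith
  · gcongr

theorem sum_sq_starWalk_iterate_le {n : ℕ} (hn : 1 ≤ n) {f : Equiv.Perm (Fin n) → ℝ}
    (hf : ∑ g, f g = 0) (l : ℕ) :
    ∑ g, starWalk^[l] f g ^ 2 ≤ ((1 - 1 / n : ℝ) ^ l) ^ 2 * ∑ g, f g ^ 2 := by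
  induction l generalizing f with
  | zero => simp
  | succ l ih =>
    rw [Function.iterate_succ_apply]
    refine (ih (by rw [sum_starWalk hn, hf])).trans ?_
    calc _ ≤ ((1 - 1 / n : ℝ) ^ l) ^ 2 * ((1 - 1 / n : ℝ) ^ 2 * ∑ g, f g ^ 2) :=
          mul_le_mul_of_nonneg_left (sum_sq_starWalk_le hn hf) (sq_nonneg _)
      _ = _ := by ring

/-- The walk started at the identity approaches the uniform distribution in mean square. -/
theorem sum_sq_uniform_sub_starWalk_iterate_le {n : ℕ} (hn : 1 ≤ n) (l : ℕ) :
    ∑ g : Equiv.Perm (Fin n), (1 / (n.factorial : ℝ) - starWalk^[l] (Pi.single 1 1) g) ^ 2 ≤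
      Real.exp (-((l : ℝ) / n)) ^ 2 := by
  have hn1 : (1 : ℝ) ≤ n := by exact_mod_cast hn
  have hn0 : (n : ℝ) ≠ 0 := by positivity
  have hN0 : (n.factorial : ℝ) ≠ 0 := by exact_mod_cast n.factorial_ne_zero
  set c : ℝ := 1 / (n.factorial : ℝ) with hc
  have hcard : ((Finset.univ : Finset (Equiv.Perm (Fin n))).card : ℝ) * c = 1 := by
    rw [Finset.card_univ, Fintype.card_perm, Fintype.card_fin, hc]; field_simp
  -- Constants are fixed by the walk, so it commutes with `f ↦ c - f`.
  have hwalk : ∀ (l : ℕ) (f : Equiv.Perm (Fin n) → ℝ),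
      starWalk^[l] (fun g => c - f g) = fun g => c - starWalk^[l] f g := by
    intro l
    induction l with
    | zero => intro f; rfl
    | succ l ih =>
      intro f
      rw [Function.iterate_succ_apply, Function.iterate_succ_apply, ← ih]
      congr 1
      funext g
      simp only [starWalk, Finset.sum_sub_distrib, Finset.sum_const, card_starTranspositions,
        nsmul_eq_mul, Nat.cast_sub hn]
      field_simp
      push_cast
      ring
  have hsum : ∑ g : Equiv.Perm (Fin n), (c - (Pi.single 1 1 : Equiv.Perm (Fin n) → ℝ) g) = 0 := by
    rw [Finset.sum_sub_distrib, Finset.sum_const, nsmul_eq_mul, hcard]; simp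
  have h := sum_sq_starWalk_iterate_le hn hsum l
  simp only [hwalk] at h
  refine h.trans ?_
  have h1 : ∑ g : Equiv.Perm (Fin n), (c - (Pi.single 1 1 : Equiv.Perm (Fin n) → ℝ) g) ^ 2 ≤ 1 := by
    -- Since the point mass is idempotent, the square is affine in it; the sum is `c + (1 - 2c) = 1
    -- - c`.
    have h2 : ∀ g : Equiv.Perm (Fin n), (c - (Pi.single 1 1 : Equiv.Perm (Fin n) → ℝ) g) ^ 2 =
        c * c + (1 - 2 * c) * (Pi.single 1 1 : Equiv.Perm (Fin n) → ℝ) g := by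
      intro g
      by_cases hg : g = 1
      · subst hg; simp; ring
      · simp [hg]; ring
    rw [Finset.sum_congr rfl fun g _ => h2 g, Finset.sum_add_distrib, Finset.sum_const,
      nsmul_eq_mul, ← mul_assoc, hcard, ← Finset.mul_sum]
    have : 0 ≤ c := by positivity
    simp
    linarith
  have h0 : 0 ≤ (1 - 1 / n : ℝ) := by
    rw [sub_nonneg, div_le_one (by positivity)]; exact hn1
  have h3 : (1 - 1 / n : ℝ) ^ l ≤ Real.exp (-((l : ℝ) / n)) := by
    have := Real.add_one_le_exp (-(1 / n : ℝ))
    calc (1 - 1 / n : ℝ) ^ l ≤ Real.exp (-(1 / n : ℝ)) ^ l := by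
          gcongr; linarith
      _ = _ := by rw [← Real.exp_nat_mul]; congr 1; ring
  calc _ ≤ ((1 - 1 / n : ℝ) ^ l) ^ 2 * 1 := mul_le_mul_of_nonneg_left h1 (sq_nonneg _)
    _ ≤ _ := by rw [mul_one]; gcongr

/-! ### Relabelled graphs -/

theorem graphPerm_map {n : ℕ} (σ : Equiv.Perm (Fin n)) (x : Edge n → Fin 2) (e : Edge n) :
    graphPerm n σ x (e.map σ) = x e := by
  change x ((edgePerm n σ).symm (edgePerm n σ e)) = x e
  rw [Equiv.symm_apply_apply]

theorem Edge.map_mkEdge {n : ℕ} (σ : Equiv.Perm (Fin n)) {i j : Fin n} (h : i ≠ j) :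
    (mkEdge i j h).map σ = mkEdge (σ i) (σ j) (σ.injective.ne h) :=
  Subtype.ext rfl

theorem Edge.exists_eq_mkEdge {n : ℕ} (e : Edge n) : ∃ i j, ∃ h : i ≠ j, e = mkEdge i j h := by
  obtain ⟨e, he⟩ := e
  induction e with
  | _ i j => exact ⟨i, j, by simpa using he, rfl⟩

theorem graphOf_adj_iff {n : ℕ} (x : Edge n → Fin 2) {i j : Fin n} (h : i ≠ j) :
    (graphOf x).Adj i j ↔ x (mkEdge i j h) = 1 :=
  ⟨fun ⟨_, hx⟩ => hx, fun hx => ⟨h, hx⟩⟩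

theorem graphOf_graphPerm_adj_iff {n : ℕ} (σ : Equiv.Perm (Fin n)) (x : Edge n → Fin 2)
    (i j : Fin n) : (graphOf (graphPerm n σ x)).Adj (σ i) (σ j) ↔ (graphOf x).Adj i j := by
  by_cases h : i = j
  · subst h
    simp
  · rw [graphOf_adj_iff _ h, graphOf_adj_iff _ (σ.injective.ne h), ← Edge.map_mkEdge σ h,
      graphPerm_map]

theorem graphOf_graphPerm {n : ℕ} (σ : Equiv.Perm (Fin n)) (x : Edge n → Fin 2) :
    graphOf (graphPerm n σ x) = (graphOf x).map σ := by
  ext a b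
  obtain ⟨i, rfl⟩ := σ.surjective a
  obtain ⟨j, rfl⟩ := σ.surjective b
  rw [graphOf_graphPerm_adj_iff, SimpleGraph.map_adj']
  constructor
  · exact fun h => ⟨σ.injective.ne h.ne, i, j, h, rfl, rfl⟩
  · rintro ⟨-, u, v, h, hu, hv⟩
    rwa [← σ.injective hu, ← σ.injective hv]

theorem graphOf_injective (n : ℕ) : Function.Injective (graphOf (n := n)) := by
  intro x y h
  funext e
  obtain ⟨i, j, hij, rfl⟩ := e.exists_eq_mkEdge
  have h1 : x (mkEdge i j hij) = 1 ↔ y (mkEdge i j hij) = 1 := by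
    rw [← graphOf_adj_iff, ← graphOf_adj_iff, h]
  revert h1
  generalize x (mkEdge i j hij) = a
  generalize y (mkEdge i j hij) = b
  revert a b
  decide

theorem graphPerm_eq_iff {n : ℕ} (σ : Equiv.Perm (Fin n)) (x y : Edge n → Fin 2) :
    graphPerm n σ x = y ↔ ∀ {i j}, (graphOf y).Adj (σ i) (σ j) ↔ (graphOf x).Adj i j := by
  constructor
  · rintro rfl i j
    exact graphOf_graphPerm_adj_iff σ x i j
  · intro h
    refine graphOf_injective n ?_
    ext a b
    obtain ⟨i, rfl⟩ := σ.surjective a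
    obtain ⟨j, rfl⟩ := σ.surjective b
    rw [graphOf_graphPerm_adj_iff, h]

/-- The relabellings taking `x` to `y` are the isomorphisms of the graphs. -/
def relabellingEquivIso {n : ℕ} (x y : Edge n → Fin 2) :
    {σ : Equiv.Perm (Fin n) // graphPerm n σ x = y} ≃ (graphOf x ≃g graphOf y) where
  toFun σ := ⟨σ.1, (graphPerm_eq_iff σ.1 x y).mp σ.2⟩
  invFun f := ⟨f.toEquiv, (graphPerm_eq_iff f.toEquiv x y).mpr f.map_rel_iff'⟩
  left_inv _ := rfl
  right_inv _ := rfl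

theorem mem_graphOrbit_iff {n : ℕ} {x y : Edge n → Fin 2} :
    y ∈ graphOrbit x ↔ ∃ σ, graphPerm n σ x = y := by
  simp [graphOrbit]

theorem mem_graphOrbit_iff_nonempty_iso {n : ℕ} {x y : Edge n → Fin 2} :
    y ∈ graphOrbit x ↔ Nonempty (graphOf x ≃g graphOf y) := by
  rw [mem_graphOrbit_iff, ← (relabellingEquivIso x y).nonempty_congr, nonempty_subtype]

theorem mem_graphStabilizer_iff {n : ℕ} {x : Edge n → Fin 2} {σ : Equiv.Perm (Fin n)} :
    σ ∈ graphStabilizer x ↔ graphPerm n σ x = x :=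
  Iff.rfl

theorem card_graphStabilizer {n : ℕ} (x : Edge n → Fin 2) :
    Nat.card (graphStabilizer x) = Nat.card (graphOf x ≃g graphOf x) :=
  Nat.card_congr (relabellingEquivIso x x)

/-- If `y = σ x`, the fibre is the left coset of the stabilizer by `σ`. -/
theorem card_relabelling {n : ℕ} {x y : Edge n → Fin 2} (hy : y ∈ graphOrbit x) :
    (Finset.univ.filter fun g => graphPerm n g x = y).card = Nat.card (graphStabilizer x) := by
  obtain ⟨σ, rfl⟩ := mem_graphOrbit_iff.mp hy
  rw [← Fintype.card_subtype, ← Nat.card_eq_fintype_card]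
  refine Nat.card_congr ((Equiv.mulLeft σ⁻¹).subtypeEquiv fun g => ?_)
  rw [mem_graphStabilizer_iff, Equiv.coe_mulLeft, map_mul, map_inv, Equiv.Perm.mul_apply,
    Equiv.Perm.inv_eq_iff_eq]

theorem card_graphStabilizer_le {n : ℕ} (x : Edge n → Fin 2) :
    Nat.card (graphStabilizer x) ≤ n.factorial := by
  have := Subgroup.card_le_card_group (graphStabilizer x)
  rwa [Nat.card_eq_fintype_card (α := Equiv.Perm (Fin n)), Fintype.card_perm,
    Fintype.card_fin] at this

/-! ### States that are diagonal in the computational basis -/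

section Diagonal

variable {ι : Type*} [Fintype ι] [DecidableEq ι]

theorem pureState_eq_diagonal (x : ι → Fin 2) :
    pureState x = Matrix.diagonal fun y => if x = y then 1 else 0 := by
  ext y z
  rw [pureState, Matrix.vecMulVec_apply, Matrix.diagonal_apply, ket]
  by_cases hy : x = y
  · subst hy
    by_cases hz : x = z
    · subst hz; simp
    · simp [hz, Ne.symm hz]
  · simp [hy, Ne.symm hy]

theorem diagonal_mulVec_ket (d : (ι → Fin 2) → ℂ) (y : ι → Fin 2) :
    Matrix.diagonal d *ᵥ ket y = d y • ket y := by
  rw [ket, Matrix.diagonal_mulVec_single, ← Pi.single_smul, smul_eq_mul]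

theorem diagValue_diagonal (d : (ι → Fin 2) → ℂ) (y : ι → Fin 2) :
    diagValue (Matrix.diagonal d) y = d y := by
  rw [diagValue, diagonal_mulVec_ket, dotProduct_smul, ket]
  simp

theorem diagValue_sub (A B : Matrix (ι → Fin 2) (ι → Fin 2) ℂ) (y : ι → Fin 2) :
    diagValue (A - B) y = diagValue A y - diagValue B y := by
  rw [diagValue, Matrix.sub_mulVec, dotProduct_sub]
  rfl

end Diagonal

theorem basisPermUnitary_mulVec_single {B : Type*} [Fintype B] [DecidableEq B]
    (τ : Equiv.Perm B) (x : B) :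
    (basisPermUnitary B τ : Matrix B B ℂ) *ᵥ Pi.single x 1 = Pi.single (τ x) 1 := by
  ext y
  rw [Matrix.mulVec_single_one, Matrix.col_apply, Pi.single_apply]
  rfl

theorem graphRep_mul_pureState_mul {n : ℕ} (g : Equiv.Perm (Fin n)) (x : Edge n → Fin 2) :
    (graphRep n g : Matrix (Edge n → Fin 2) (Edge n → Fin 2) ℂ) * pureState x *
      (graphRep n g : Matrix (Edge n → Fin 2) (Edge n → Fin 2) ℂ)ᴴ =
      pureState (graphPerm n g x) := by
  have h : (graphRep n g : Matrix (Edge n → Fin 2) (Edge n → Fin 2) ℂ) *ᵥ ket x =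
      ket (graphPerm n g x) := basisPermUnitary_mulVec_single _ _
  rw [pureState, pureState, Matrix.mul_vecMulVec, Matrix.vecMulVec_mul, ← Matrix.star_mulVec, h]

/-! ### Channels as convolutions on mixing weights -/

/-- The mixture of the relabellings of `|x⟩⟨x|` with weights `w`. -/
noncomputable def relabelledState {n : ℕ} (x : Edge n → Fin 2) (w : Equiv.Perm (Fin n) → ℝ) :
    Matrix (Edge n → Fin 2) (Edge n → Fin 2) ℂ :=
  ∑ g, (w g : ℂ) • pureState (graphPerm n g x)

theorem relabelledState_eq_diagonal {n : ℕ} (x : Edge n → Fin 2) (w : Equiv.Perm (Fin n) → ℝ) :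
    relabelledState x w = Matrix.diagonal fun y =>
      ((∑ g with graphPerm n g x = y, w g : ℝ) : ℂ) := by
  ext y z
  rw [relabelledState, Matrix.sum_apply]
  simp only [pureState_eq_diagonal, Matrix.smul_apply, Matrix.diagonal_apply, smul_eq_mul]
  by_cases h : y = z
  · simp [h, Finset.sum_filter, apply_ite Complex.ofReal]
  · simp [h]

theorem relabelledState_single {n : ℕ} (x : Edge n → Fin 2) :
    relabelledState x (Pi.single 1 1) = pureState x := by
  rw [relabelledState, Finset.sum_eq_single 1]
  · simp
  · intro g _ hg; simp [hg]
  · simp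

theorem groupChannel_relabelledState {n : ℕ} (x : Edge n → Fin 2)
    (u w : Equiv.Perm (Fin n) → ℝ) :
    groupChannel (graphRep n) u (relabelledState x w) =
      relabelledState x fun g => ∑ h, u h * w (h⁻¹ * g) := by
  have h1 : ∀ h, (u h : ℂ) • ((graphRep n h : Matrix (Edge n → Fin 2) (Edge n → Fin 2) ℂ) *
      relabelledState x w * (graphRep n h : Matrix (Edge n → Fin 2) (Edge n → Fin 2) ℂ)ᴴ) =
      ∑ g, ((u h * w (h⁻¹ * g) : ℝ) : ℂ) • pureState (graphPerm n g x) := by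
    intro h
    rw [relabelledState, Finset.mul_sum, Finset.sum_mul, Finset.smul_sum,
      ← Equiv.sum_comp (Equiv.mulLeft h) fun g =>
        ((u h * w (h⁻¹ * g) : ℝ) : ℂ) • pureState (graphPerm n g x)]
    refine Finset.sum_congr rfl fun g _ => ?_
    rw [mul_smul_comm, smul_mul_assoc, graphRep_mul_pureState_mul, smul_smul, Equiv.coe_mulLeft]
    simp only [inv_mul_cancel_left, map_mul, Equiv.Perm.mul_apply]
    push_cast
    rfl
  rw [groupChannel, Finset.sum_congr rfl fun h _ => h1 h, Finset.sum_comm, relabelledState]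
  refine Finset.sum_congr rfl fun g _ => ?_
  rw [← Finset.sum_smul]
  push_cast
  rfl

theorem uniformChannel_pureState {n : ℕ} (x : Edge n → Fin 2) :
    uniformChannel (graphRep n) (pureState x) =
      relabelledState x fun _ => 1 / (n.factorial : ℝ) := by
  rw [uniformChannel, groupChannel, relabelledState]
  refine Finset.sum_congr rfl fun g _ => ?_
  rw [graphRep_mul_pureState_mul, Fintype.card_perm, Fintype.card_fin]

theorem generatorChannel_relabelledState {n : ℕ} (hn : 1 ≤ n) (x : Edge n → Fin 2)
    (w : Equiv.Perm (Fin n) → ℝ) :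
    generatorChannel (graphRep n) (starTranspositions n) (relabelledState x w) =
      relabelledState x (starWalk w) := by
  rw [generatorChannel, groupChannel_relabelledState]
  congr 1
  funext g
  simp only [ite_mul, zero_mul]
  rw [← Finset.sum_filter, Finset.filter_mem_eq_inter, Finset.univ_inter, ← Finset.mul_sum,
    Finset.sum_insert (one_notMem_starTranspositions n), card_starTranspositions, Nat.cast_sub hn,
    Nat.cast_one, add_sub_cancel, inv_one, one_mul, starWalk]
  congr 2
  exact Finset.sum_congr rfl fun h hh => by rw [inv_eq_self_of_mem_starTranspositions hh]

theorem generatorChannel_iterate_pureState {n : ℕ} (hn : 1 ≤ n) (x : Edge n → Fin 2) (l : ℕ) :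
    (generatorChannel (graphRep n) (starTranspositions n))^[l] (pureState x) =
      relabelledState x (starWalk^[l] (Pi.single 1 1)) := by
  induction l with
  | zero => exact (relabelledState_single x).symm
  | succ l ih =>
    rw [Function.iterate_succ_apply', Function.iterate_succ_apply', ih,
      generatorChannel_relabelledState hn]

theorem relabelledState_mulVec_ket {n : ℕ} (x y : Edge n → Fin 2)
    (w : Equiv.Perm (Fin n) → ℝ) :
    relabelledState x w *ᵥ ket y = diagValue (relabelledState x w) y • ket y := by
  rw [relabelledState_eq_diagonal, diagonal_mulVec_ket, diagValue_diagonal]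

theorem diagValue_relabelledState {n : ℕ} (x y : Edge n → Fin 2) (w : Equiv.Perm (Fin n) → ℝ) :
    diagValue (relabelledState x w) y = ((∑ g with graphPerm n g x = y, w g : ℝ) : ℂ) := by
  rw [relabelledState_eq_diagonal, diagValue_diagonal]

theorem diagValue_relabelledState_eq_zero {n : ℕ} {x y : Edge n → Fin 2}
    (hy : y ∉ graphOrbit x) (w : Equiv.Perm (Fin n) → ℝ) :
    diagValue (relabelledState x w) y = 0 := by
  rw [diagValue_relabelledState, Finset.filter_eq_empty_iff.mpr, Finset.sum_empty,
    Complex.ofReal_zero]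
  exact fun g _ hg => hy (mem_graphOrbit_iff.mpr ⟨g, hg⟩)

theorem diagValue_uniformChannel {n : ℕ} {x y : Edge n → Fin 2} (hy : y ∈ graphOrbit x) :
    diagValue (uniformChannel (graphRep n) (pureState x)) y =
      (Nat.card (graphStabilizer x) : ℂ) / (n.factorial : ℂ) := by
  rw [uniformChannel_pureState, diagValue_relabelledState, Finset.sum_const, card_relabelling hy,
    nsmul_eq_mul, mul_one_div]
  push_cast
  rfl

theorem uniformChannel_eq_smul_sum {n : ℕ} (x : Edge n → Fin 2) :
    uniformChannel (graphRep n) (pureState x) =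
      ((Nat.card (graphStabilizer x) : ℂ) / (n.factorial : ℂ)) •
        ∑ y ∈ graphOrbit x, pureState y := by
  rw [uniformChannel_pureState, relabelledState, Finset.smul_sum]
  rw [← Finset.sum_fiberwise_of_maps_to (s := Finset.univ) (t := graphOrbit x)
    (g := fun g => graphPerm n g x) fun g _ => mem_graphOrbit_iff.mpr ⟨g, rfl⟩]
  refine Finset.sum_congr rfl fun y hy => ?_
  rw [Finset.sum_congr rfl fun g hg => by rw [(Finset.mem_filter.mp hg).2], Finset.sum_const,
    card_relabelling hy, ← Nat.cast_smul_eq_nsmul ℂ, smul_smul]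
  push_cast
  rw [mul_one_div]

theorem norm_diagValue_uniformChannel_sub_le {n : ℕ} (hn : 1 ≤ n) (x : Edge n → Fin 2) (l : ℕ)
    (y : Edge n → Fin 2) :
    ‖diagValue (uniformChannel (graphRep n) (pureState x) -
        (generatorChannel (graphRep n) (starTranspositions n))^[l] (pureState x)) y‖ ≤
      Real.sqrt (Nat.card (graphStabilizer x)) * Real.exp (-((l : ℝ) / (n : ℝ))) := by
  rw [uniformChannel_pureState, generatorChannel_iterate_pureState hn, diagValue_sub]
  by_cases hy : y ∈ graphOrbit x
  swap
  · rw [diagValue_relabelledState_eq_zero hy, diagValue_relabelledState_eq_zero hy, sub_zero,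
      norm_zero]
    positivity
  rw [diagValue_relabelledState, diagValue_relabelledState, ← Complex.ofReal_sub,
    Complex.norm_real, ← Finset.sum_sub_distrib, Real.norm_eq_abs]
  refine abs_le_of_sq_le_sq ?_ (by positivity)
  -- Cauchy–Schwarz over the coset, which has `|H(x)|` elements; the sum of squares is then enlarged
  -- to the whole group.
  refine sq_sum_le_card_mul_sum_sq.trans ?_
  rw [card_relabelling hy, mul_pow, Real.sq_sqrt (Nat.cast_nonneg _)]
  refine mul_le_mul_of_nonneg_left ?_ (Nat.cast_nonneg _)
  exact (Finset.sum_le_sum_of_subset_of_nonneg (Finset.filter_subset _ _)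
    fun g _ _ => sq_nonneg _).trans (sum_sq_uniform_sub_starWalk_iterate_le hn l)

/-! ### Factorizations of permutations into swaps -/

theorem exists_list_prod_eq_of_forall_mem {A B M : Type*} [Monoid M] {P : B → Prop} {F : A → M}
    {G : B → M} {m : ℕ} (L : List A)
    (h : ∀ a ∈ L, ∃ c : List B, (∀ b ∈ c, P b) ∧ c.length ≤ m ∧ (c.map G).prod = F a) :
    ∃ c : List B, (∀ b ∈ c, P b) ∧ c.length ≤ L.length * m ∧
      (c.map G).prod = (L.map F).prod := by
  induction L with
  | nil => exact ⟨[], by simp⟩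
  | cons a L ih =>
    obtain ⟨c, hc, hcl, hcp⟩ := h a List.mem_cons_self
    obtain ⟨d, hd, hdl, hdp⟩ := ih fun b hb => h b (List.mem_cons_of_mem _ hb)
    refine ⟨c ++ d, ?_, ?_, ?_⟩
    · intro b hb
      exact (List.mem_append.mp hb).elim (hc b) (hd b)
    · rw [List.length_append, List.length_cons, Nat.succ_mul]
      omega
    · rw [List.map_append, List.prod_append, hcp, hdp, List.map_cons, List.prod_cons]

/-- Conjugating the swap of positions `i + 1` and `j` by the adjacent swap of `i` and `i + 1` moves
its left end to `i`, at the cost of two more swaps. -/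
theorem exists_covBy_swaps_of_orderIso {α : Type*} [LinearOrder α] {N : ℕ} (e : Fin N ≃o α)
    (d : ℕ) : ∀ (i : ℕ) (h : i + d + 1 < N), ∃ c : List (α × α), (∀ s ∈ c, s.1 ⋖ s.2) ∧
      c.length = 2 * d + 1 ∧ (c.map fun s => Equiv.swap s.1 s.2).prod =
        Equiv.swap (e ⟨i, by omega⟩) (e ⟨i + d + 1, h⟩) := by
  have hcov : ∀ (i : ℕ) (h : i + 1 < N), e ⟨i, by omega⟩ ⋖ e ⟨i + 1, h⟩ := by
    intro i h
    rw [apply_covBy_apply_iff]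
    refine ⟨Fin.mk_lt_mk.mpr (by omega), fun c h1 h2 => ?_⟩
    rw [Fin.lt_def] at h1 h2
    simp only at h1 h2
    omega
  induction d with
  | zero =>
    exact fun i h => ⟨[(e ⟨i, by omega⟩, e ⟨i + 1, h⟩)], by simp [hcov], rfl, by simp⟩
  | succ d ih =>
    intro i h
    obtain ⟨c, hc, hl, hp⟩ := ih (i + 1) (by omega)
    have hs := hcov i (by omega)
    have h' : i + 1 < N := by omega
    refine ⟨(e ⟨i, by omega⟩, e ⟨i + 1, h'⟩) :: (c ++ [(e ⟨i, by omega⟩, e ⟨i + 1, h'⟩)]),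
      ?_, ?_, ?_⟩
    · intro s hs'
      rw [List.mem_cons, List.mem_append, List.mem_singleton] at hs'
      rcases hs' with rfl | hs' | rfl
      · exact hs
      · exact hc s hs'
      · exact hs
    · simp [hl]; omega
    · have := Equiv.swap_apply_apply (Equiv.swap (e ⟨i, by omega⟩) (e ⟨i + 1, by omega⟩))
        (e ⟨i + 1, by omega⟩) (e ⟨i + 1 + d + 1, by omega⟩)
      rw [Equiv.swap_apply_right, Equiv.swap_apply_of_ne_of_ne, Equiv.swap_inv, ← hp] at this
      · simp only [List.map_cons, List.map_append, List.prod_cons, List.prod_append, List.map_nil,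
          List.prod_nil, mul_one]
        rw [← mul_assoc, ← this]
        congr 3
        omega
      · exact e.injective.ne (by simp [Fin.ext_iff]; omega)
      · exact e.injective.ne (by simp [Fin.ext_iff]; omega)

theorem exists_covBy_swaps {α : Type*} [Fintype α] [LinearOrder α] {a b : α} (hab : a ≠ b) :
    ∃ c : List (α × α), (∀ s ∈ c, s.1 ⋖ s.2) ∧ c.length ≤ 2 * Fintype.card α - 3 ∧
      (c.map fun s => Equiv.swap s.1 s.2).prod = Equiv.swap a b := by
  wlog h : a < b generalizing a b
  · rw [Equiv.swap_comm]
    exact this hab.symm (lt_of_le_of_ne (not_lt.mp h) hab.symm)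
  let e := monoEquivOfFin α rfl
  have hlt : (e.symm a).val < (e.symm b).val := e.symm.lt_iff_lt.mpr h
  have hb := (e.symm b).isLt
  obtain ⟨c, hc, hl, hp⟩ := exists_covBy_swaps_of_orderIso e
    ((e.symm b).val - (e.symm a).val - 1) (e.symm a).val (by omega)
  refine ⟨c, hc, by omega, ?_⟩
  rw [hp]
  congr 1
  · exact e.apply_symm_apply a
  · convert e.apply_symm_apply b using 2
    exact Fin.ext (by simp only; omega)

theorem Edge.mem_mkEdge {n : ℕ} {i j k : Fin n} (h : i ≠ j) :
    k ∈ (mkEdge i j h).1 ↔ k = i ∨ k = j :=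
  Sym2.mem_iff

/-- The set `K` of third vertices grows one at a time. A new `k` contributes the swap of `{p,k}` and
`{q,k}`, both untouched so far; every other edge through `k` avoids `p` and `q` and is fixed by `(p
q)`. -/
theorem exists_edge_swaps_aux {n : ℕ} {p q : Fin n} (hpq : p ≠ q) (K : Finset (Fin n)) :
    p ∉ K → q ∉ K → ∃ L : List (Edge n × Edge n), L.length = K.card ∧ (∀ s ∈ L, s.1 ≠ s.2) ∧
      ∀ e : Edge n, (L.map fun s => Equiv.swap s.1 s.2).prod e =
        if ∃ k ∈ K, k ∈ e.1 then e.map (Equiv.swap p q) else e := by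
  induction K using Finset.induction_on with
  | empty => exact fun _ _ => ⟨[], by simp⟩
  | insert k K hk ih =>
    intro hp hq
    rw [Finset.mem_insert, not_or] at hp hq
    obtain ⟨L, hl, hne, hL⟩ := ih hp.2 hq.2
    set Q := (L.map fun s => Equiv.swap s.1 s.2).prod with hQ
    set P₁ := mkEdge p k hp.1 with hP₁
    set P₂ := mkEdge q k hq.1 with hP₂
    have hPne : P₁ ≠ P₂ := by
      intro h
      have : p ∈ P₂.1 := h ▸ (Edge.mem_mkEdge hp.1).mpr (Or.inl rfl)
      exact ((Edge.mem_mkEdge hq.1).mp this).elim hpq hp.1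
    have hQ₁ : Q P₁ = P₁ := by
      rw [hL, if_neg]
      rintro ⟨j, hj, hjP⟩
      rcases (Edge.mem_mkEdge hp.1).mp hjP with rfl | rfl
      · exact hp.2 hj
      · exact hk hj
    have hQ₂ : Q P₂ = P₂ := by
      rw [hL, if_neg]
      rintro ⟨j, hj, hjP⟩
      rcases (Edge.mem_mkEdge hq.1).mp hjP with rfl | rfl
      · exact hq.2 hj
      · exact hk hj
    have hτk : Equiv.swap p q k = k := Equiv.swap_apply_of_ne_of_ne (Ne.symm hp.1) (Ne.symm hq.1)
    have hm₁ : P₁.map (Equiv.swap p q) = P₂ := by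
      rw [hP₁, Edge.map_mkEdge]
      simp only [Equiv.swap_apply_left, hτk]
      rfl
    have hm₂ : P₂.map (Equiv.swap p q) = P₁ := by
      rw [hP₂, Edge.map_mkEdge]
      simp only [Equiv.swap_apply_right, hτk]
      rfl
    refine ⟨(P₁, P₂) :: L, by rw [List.length_cons, hl, Finset.card_insert_of_notMem hk], ?_, ?_⟩
    · intro s hs
      rcases List.mem_cons.mp hs with rfl | hs
      · exact hPne
      · exact hne s hs
    · intro e
      rw [List.map_cons, List.prod_cons, Equiv.Perm.mul_apply, ← hQ]
      by_cases h₁ : e = P₁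
      · rw [h₁, hQ₁, Equiv.swap_apply_left, if_pos, hm₁]
        exact ⟨k, Finset.mem_insert_self _ _, (Edge.mem_mkEdge hp.1).mpr (Or.inr rfl)⟩
      by_cases h₂ : e = P₂
      · rw [h₂, hQ₂, Equiv.swap_apply_right, if_pos, hm₂]
        exact ⟨k, Finset.mem_insert_self _ _, (Edge.mem_mkEdge hq.1).mpr (Or.inr rfl)⟩
      rw [Equiv.swap_apply_of_ne_of_ne (fun h => h₁ (Q.injective (h.trans hQ₁.symm)))
        (fun h => h₂ (Q.injective (h.trans hQ₂.symm))), hL]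
      by_cases hK : ∃ j ∈ K, j ∈ e.1
      · rw [if_pos hK, if_pos]
        obtain ⟨j, hj, hje⟩ := hK
        exact ⟨j, Finset.mem_insert_of_mem hj, hje⟩
      rw [if_neg hK]
      split_ifs with hK'
      swap
      · rfl
      obtain ⟨j, hj, hje⟩ := hK'
      rcases Finset.mem_insert.mp hj with rfl | hj
      swap
      · exact absurd ⟨j, hj, hje⟩ hK
      obtain ⟨i, hi⟩ := Sym2.mem_iff_exists.mp hje
      have hip : i ≠ p := by
        rintro rfl
        exact h₁ (Subtype.ext (hi.trans Sym2.eq_swap))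
      have hiq : i ≠ q := by
        rintro rfl
        exact h₂ (Subtype.ext (hi.trans Sym2.eq_swap))
      refine Subtype.ext ?_
      change e.1 = Sym2.map (Equiv.swap p q) e.1
      rw [hi, Sym2.map_mk, hτk, Equiv.swap_apply_of_ne_of_ne hip hiq]

/-- A transposition of two vertices acts on the edges as a product of `n - 2` transpositions. -/
theorem exists_edge_swaps {n : ℕ} {p q : Fin n} (hpq : p ≠ q) :
    ∃ L : List (Edge n × Edge n), L.length = n - 2 ∧ (∀ s ∈ L, s.1 ≠ s.2) ∧
      (L.map fun s => Equiv.swap s.1 s.2).prod = edgePerm n (Equiv.swap p q) := by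
  obtain ⟨L, hl, hne, hL⟩ := exists_edge_swaps_aux hpq ({p, q} : Finset (Fin n))ᶜ
    (by simp) (by simp)
  refine ⟨L, by rw [hl, Finset.card_compl, Finset.card_pair hpq, Fintype.card_fin], hne, ?_⟩
  refine Equiv.ext fun e => ?_
  rw [hL]
  change _ = e.map (Equiv.swap p q)
  split_ifs with h
  · rfl
  obtain ⟨i, j, hij, rfl⟩ := e.exists_eq_mkEdge
  have key : ∀ k, k = i ∨ k = j → k = p ∨ k = q := by
    intro k hk
    by_contra hc
    exact h ⟨k, by simpa using hc, (Edge.mem_mkEdge hij).mpr hk⟩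
  refine Subtype.ext ?_
  change s(i, j) = s(Equiv.swap p q i, Equiv.swap p q j)
  -- An edge without a third vertex is `{p, q}`, which the transposition preserves.
  rcases key i (Or.inl rfl) with rfl | rfl <;> rcases key j (Or.inr rfl) with rfl | rfl
  · exact absurd rfl hij
  · rw [Equiv.swap_apply_left, Equiv.swap_apply_right, Sym2.eq_swap]
  · rw [Equiv.swap_apply_left, Equiv.swap_apply_right, Sym2.eq_swap]
  · exact absurd rfl hij

/-! ### Circuits -/

theorem prod_map_swapGate {ι : Type*} [Fintype ι] [DecidableEq ι] (L : List (ι × ι)) :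
    (L.map fun s => swapGate s.1 s.2).prod =
      (basisPermUnitary (ι → Fin 2) (bitPerm ι (L.map fun s => Equiv.swap s.1 s.2).prod) :
        Matrix (ι → Fin 2) (ι → Fin 2) ℂ) := by
  induction L with
  | nil => simp
  | cons s L ih =>
    rw [List.map_cons, List.prod_cons, List.map_cons, List.prod_cons, ih, map_mul, map_mul]
    rfl

theorem of_ite_eq_mul_of_ite_eq {B : Type*} [Fintype B] [DecidableEq B] (f g : B → B) :
    (Matrix.of fun y x => if y = f x then (1 : ℂ) else 0) *
      (Matrix.of fun y x => if y = g x then (1 : ℂ) else 0) =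
      Matrix.of fun y x => if y = f (g x) then (1 : ℂ) else 0 := by
  ext i j
  simp [Matrix.mul_apply]

theorem swapGate_eq_cnotGate_mul {ι : Type*} [Fintype ι] [DecidableEq ι] {i j : ι}
    (hij : i ≠ j) : swapGate i j = cnotGate i j * cnotGate j i * cnotGate i j := by
  rw [cnotGate, cnotGate, of_ite_eq_mul_of_ite_eq, of_ite_eq_mul_of_ite_eq]
  change Matrix.of (fun y x : ι → Fin 2 =>
    if y = x ∘ (Equiv.swap i j).symm then (1 : ℂ) else 0) = _
  congr 1
  funext y x
  congr 2
  funext k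
  have h2 : ∀ a b : Fin 2, a + (b + a) = b := by decide
  have h3 : ∀ a b : Fin 2, b + a + b = a := by decide
  rw [Equiv.symm_swap, Function.comp_apply]
  by_cases hkj : k = j
  · subst hkj
    simp [hij, hij.symm, h2, h3]
  · by_cases hki : k = i
    · subst hki
      simp [hij, hij.symm, h2, h3]
    · simp [Equiv.swap_apply_of_ne_of_ne hki hkj, hki, hkj]

theorem exists_neighbouring_swaps {n : ℕ} {p q : Fin n} (hpq : p ≠ q) :
    ∃ c : List (Edge n × Edge n), (∀ s ∈ c, s.1 ⋖ s.2) ∧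
      c.length ≤ (n - 2) * (2 * n.choose 2 - 3) ∧
      (c.map fun s => swapGate s.1 s.2).prod =
        (graphRep n (Equiv.swap p q) : Matrix (Edge n → Fin 2) (Edge n → Fin 2) ℂ) := by
  obtain ⟨L, hl, hne, hL⟩ := exists_edge_swaps hpq
  obtain ⟨c, hc, hcl, hcp⟩ := exists_list_prod_eq_of_forall_mem L fun s hs =>
    exists_covBy_swaps (hne s hs)
  refine ⟨c, hc, by rwa [hl, card_edge] at hcl, ?_⟩
  rw [prod_map_swapGate]
  erw [hcp]
  rw [hL]
  rfl

theorem exists_elementary_circuit {n : ℕ} {p q : Fin n} (hpq : p ≠ q) :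
    ∃ c : List (Matrix (Edge n → Fin 2) (Edge n → Fin 2) ℂ), (∀ U ∈ c, IsElementaryGate U) ∧
      c.length ≤ (n - 2) * 3 ∧
      c.prod = (graphRep n (Equiv.swap p q) : Matrix (Edge n → Fin 2) (Edge n → Fin 2) ℂ) := by
  obtain ⟨L, hl, hne, hL⟩ := exists_edge_swaps hpq
  obtain ⟨c, hc, hcl, hcp⟩ := exists_list_prod_eq_of_forall_mem (P := IsElementaryGate)
    (F := fun s : Edge n × Edge n => swapGate s.1 s.2) (G := id) (m := 3) L fun s hs =>
      ⟨[cnotGate s.1 s.2, cnotGate s.2 s.1, cnotGate s.1 s.2], by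
        intro b hb
        simp only [List.mem_cons, List.not_mem_nil, or_false] at hb
        rcases hb with rfl | rfl | rfl
        · exact Or.inr ⟨_, _, hne s hs, rfl⟩
        · exact Or.inr ⟨_, _, (hne s hs).symm, rfl⟩
        · exact Or.inr ⟨_, _, hne s hs, rfl⟩, le_rfl, by
        simp [swapGate_eq_cnotGate_mul (hne s hs), mul_assoc]⟩
  refine ⟨c, hc, by rwa [hl] at hcl, ?_⟩
  rw [List.map_id] at hcp
  rw [hcp, prod_map_swapGate, hL]
  rfl

/-! ### Numerical estimates and injectivity -/

theorem two_mul_choose_two (n : ℕ) : 2 * n.choose 2 = n * (n - 1) := by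
  rw [Nat.choose_two_right, Nat.mul_div_cancel' (Nat.even_mul_pred_self n).two_dvd]

theorem factorial_three_mul_choose_three (n : ℕ) :
    Nat.factorial 3 * n.choose 3 = n * (n - 1) * (n - 2) := by
  rw [← Nat.descFactorial_eq_factorial_mul_choose]
  simp [Nat.descFactorial_succ]
  ring

/-- Dropping the `-3` gives `(n - 2) · 2N = n(n - 1)(n - 2) = 3! · C(n, 3)`. -/
theorem sub_two_mul_lt {n : ℕ} (hn : 3 ≤ n) :
    (n - 2) * (2 * n.choose 2 - 3) < Nat.factorial 3 * n.choose 3 := by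
  rw [two_mul_choose_two, factorial_three_mul_choose_three, mul_comm]
  have h : 3 * 2 ≤ n * (n - 1) := Nat.mul_le_mul hn (by omega)
  exact Nat.mul_lt_mul_of_pos_right (by omega) (by omega)

/-- This has equality at `n = 3` and fails at `n = 2`. Strictness in the logarithmic bound comes
from `n - 1 < √(n(n - 1))` instead. -/
theorem factorial_sq_le {n : ℕ} (hn : 3 ≤ n) :
    n.factorial ^ 2 ≤ (n * (n - 1)) ^ (n - 1) := by
  induction n, hn using Nat.le_induction with
  | base => decide
  | succ n hn ih =>
    obtain ⟨m, rfl⟩ : ∃ m, n = m + 2 := ⟨n - 2, by omega⟩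
    simp only [Nat.add_sub_cancel, show m + 2 - 1 = m + 1 by omega] at ih ⊢
    have h1 : (m + 1) ^ m ≤ (m + 2 + 1) ^ m := Nat.pow_le_pow_left (by omega) m
    calc (m + 2 + 1).factorial ^ 2 = (m + 2 + 1) ^ 2 * (m + 2).factorial ^ 2 := by
          rw [Nat.factorial_succ (m + 2), mul_pow]
      _ ≤ (m + 2 + 1) ^ 2 * ((m + 2) * (m + 1)) ^ (m + 1) := Nat.mul_le_mul_left _ ih
      _ = (m + 2 + 1) ^ 2 * (m + 2) ^ (m + 1) * ((m + 1) ^ m * (m + 1)) := by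
          rw [mul_pow, pow_succ (m + 1) m]; ring
      _ ≤ (m + 2 + 1) ^ 2 * (m + 2) ^ (m + 1) * ((m + 2 + 1) ^ m * (m + 2)) := by
          gcongr; omega
      _ = _ := by rw [mul_pow]; ring

theorem log_factorial_lt {n : ℕ} (hn : 3 ≤ n) :
    Real.log (n.factorial : ℝ) <
      1 / 2 * Real.sqrt (2 * (n.choose 2 : ℝ)) * Real.log (2 * (n.choose 2 : ℝ)) := by
  have hn3 : (3 : ℝ) ≤ n := by exact_mod_cast hn
  have h2N : 2 * (n.choose 2 : ℝ) = n * (n - 1) := by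
    have := two_mul_choose_two n
    have h : ((2 * n.choose 2 : ℕ) : ℝ) = ((n * (n - 1) : ℕ) : ℝ) := by rw [this]
    push_cast [Nat.cast_sub (by omega : 1 ≤ n)] at h
    exact h
  rw [h2N]
  have hlog : 0 < Real.log ((n : ℝ) * (n - 1)) := Real.log_pos (by nlinarith)
  have hsqrt : (n - 1 : ℝ) < Real.sqrt (n * (n - 1)) :=
    Real.lt_sqrt_of_sq_lt (by nlinarith)
  have h1 : 2 * Real.log (n.factorial : ℝ) ≤ (n - 1) * Real.log ((n : ℝ) * (n - 1)) := by
    have h := factorial_sq_le hn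
    have h' : ((n.factorial : ℝ)) ^ 2 ≤ ((n : ℝ) * (n - 1)) ^ (n - 1) := by
      have : ((n.factorial ^ 2 : ℕ) : ℝ) ≤ (((n * (n - 1)) ^ (n - 1) : ℕ) : ℝ) := by
        exact_mod_cast h
      push_cast [Nat.cast_sub (by omega : 1 ≤ n)] at this
      exact this
    have h3 := Real.log_le_log (by positivity) h'
    rw [Real.log_pow, Real.log_pow, Nat.cast_sub (by omega)] at h3
    exact_mod_cast h3
  nlinarith

/-- Indicator strings of single edges show that a kernel element fixes every edge. If it moved `i`,
the edge from `i` to a third vertex outside `{i, σ i}` would be moved. -/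
theorem graphRep_injective {n : ℕ} (hn : 3 ≤ n) : Function.Injective (graphRep n) := by
  rw [injective_iff_map_eq_one]
  intro σ hσ
  have hx : ∀ x : Edge n → Fin 2, graphPerm n σ x = x := by
    intro x
    have h : (graphRep n σ : Matrix (Edge n → Fin 2) (Edge n → Fin 2) ℂ) *ᵥ Pi.single x 1 =
      Pi.single (graphPerm n σ x) 1 := basisPermUnitary_mulVec_single _ _
    rw [hσ] at h
    simp only [OneMemClass.coe_one, Matrix.one_mulVec] at h
    by_contra hne
    have := congrFun h x
    rw [Pi.single_eq_same, Pi.single_eq_of_ne (Ne.symm hne)] at this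
    exact one_ne_zero this
  have he : ∀ e : Edge n, e.map σ = e := by
    intro e
    by_contra hne
    have h := congrFun (hx (Pi.single e 1)) (e.map σ)
    rw [graphPerm_map, Pi.single_eq_same, Pi.single_eq_of_ne hne] at h
    exact absurd h (by decide)
  refine Equiv.ext fun i => ?_
  by_contra hi
  change σ i ≠ i at hi
  obtain ⟨k, hk⟩ : ∃ k, k ∉ ({i, σ i} : Finset (Fin n)) := by
    by_contra! hall
    have h1 := Finset.card_le_card (fun k _ => hall k : Finset.univ ⊆ ({i, σ i} : Finset (Fin n)))
    rw [Finset.card_univ, Fintype.card_fin] at h1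
    have := h1.trans Finset.card_le_two
    omega
  rw [Finset.mem_insert, Finset.mem_singleton, not_or] at hk
  have h := he (mkEdge i k (Ne.symm hk.1))
  rw [Edge.map_mkEdge] at h
  have hm : σ i ∈ (mkEdge i k (Ne.symm hk.1)).1 := h ▸ (Edge.mem_mkEdge _).mpr (Or.inl rfl)
  rcases (Edge.mem_mkEdge _).mp hm with h | h
  · exact hi h
  · exact hk.2 h.symm

theorem efficientlyRepresentedWith_graphRep {n : ℕ} (hn : 2 ≤ n) :
    EfficientlyRepresentedWith (graphRep n) (starTranspositions n) 6 2 := by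
  have hle : n ≤ 2 * n.choose 2 := by
    rw [two_mul_choose_two]
    exact Nat.le_mul_of_pos_right n (by omega)
  have hN : (n : ℝ) ≤ 2 * (n.choose 2 : ℝ) := by exact_mod_cast hle
  have hn2 : (2 : ℝ) ≤ n := by exact_mod_cast hn
  have hpow : (Fintype.card (Edge n) : ℝ) ^ (2 : ℝ) = (n.choose 2 : ℝ) ^ 2 := by
    rw [card_edge, ← Real.rpow_natCast]
    norm_num
  -- The constants `6` and `2` follow from `n ≤ 2N` and `N ≥ 1`: `3n ≤ 6N ≤ 6N²` for the gates and
  -- `n² ≤ 4N²` for `log n! ≤ n log n ≤ n²`.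
  have hlin : 3 * (n : ℝ) ≤ 6 * (n.choose 2 : ℝ) ^ 2 := by nlinarith
  have hsq : (n : ℝ) ^ 2 ≤ 6 * (n.choose 2 : ℝ) ^ 2 := by nlinarith
  refine ⟨?_, one_notMem_starTranspositions n, mem_starTranspositions_iff_inv_mem,
    closure_starTranspositions n, ?_, ?_, ?_⟩ <;> rw [hpow]
  · rw [Fintype.card_perm, Fintype.card_fin]
    have h1 : (n.factorial : ℝ) ≤ (n : ℝ) ^ n := by exact_mod_cast n.factorial_le_pow
    have h2 := Real.log_le_log (by positivity) h1
    rw [Real.log_pow] at h2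
    have h3 := Real.log_le_self (by positivity : (0 : ℝ) ≤ n)
    nlinarith
  · intro g hg
    simp only [starTranspositions, Finset.mem_filter, Finset.mem_univ, true_and] at hg
    obtain ⟨i, j, hij, -, rfl⟩ := hg
    obtain ⟨c, hc, hl, hp⟩ := exists_elementary_circuit hij
    refine ⟨c, hc, ?_, hp⟩
    have h1 : (c.length : ℝ) ≤ 3 * n := by exact_mod_cast (by omega : c.length ≤ 3 * n)
    exact h1.trans hlin
  · rw [card_starTranspositions]
    have h1 : ((n - 1 : ℕ) : ℝ) ≤ n := by exact_mod_cast Nat.sub_le n 1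
    linarith
  · have h1 := inv_le_one_of_one_le₀ (one_le_laplacianGap hn)
    linarith

theorem mainTheorem3 :
    -- efficiently represented with respect to the star transpositions, with uniform constants
    (∃ b β : ℝ, 0 < b ∧ 0 < β ∧ ∀ n : ℕ, 2 ≤ n →
      EfficientlyRepresentedWith (graphRep n) (starTranspositions n) b β) ∧
    -- the explicit estimates behind it; the number of qubits is `n.choose 2`
    (∀ n : ℕ, Fintype.card (Edge n) = n.choose 2) ∧
    (∀ n : ℕ, 3 ≤ n → Function.Injective (graphRep n) ∧
      Real.log (n.factorial : ℝ) <
        1 / 2 * Real.sqrt (2 * (n.choose 2 : ℝ)) * Real.log (2 * (n.choose 2 : ℝ)) ∧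
      laplacianGap (starTranspositions n) = 1) ∧
    (∀ (n : ℕ) (p q : Fin n), p ≠ q → ∃ c : List (Edge n × Edge n),
      (∀ s ∈ c, s.1 ⋖ s.2) ∧
      c.length ≤ Nat.factorial 3 * n.choose 3 ∧
      (3 ≤ n → c.length < Nat.factorial 3 * n.choose 3) ∧
      (c.map fun s => swapGate s.1 s.2).prod =
        (graphRep n (Equiv.swap p q) : Matrix (Edge n → Fin 2) (Edge n → Fin 2) ℂ)) ∧
    -- the orbit state and its approximation
    (∀ (n : ℕ), 1 ≤ n → ∀ x : Edge n → Fin 2,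
      (∀ σ : Equiv.Perm (Fin n),
        graphOf (graphPerm n σ x) = (graphOf x).map σ) ∧
      (∀ y : Edge n → Fin 2, y ∈ graphOrbit x ↔ Nonempty (graphOf x ≃g graphOf y)) ∧
      Nat.card (graphStabilizer x) = Nat.card (graphOf x ≃g graphOf x) ∧
      uniformChannel (graphRep n) (pureState x) =
        ((Nat.card (graphStabilizer x) : ℂ) / (n.factorial : ℂ)) •
          ∑ y ∈ graphOrbit x, pureState y ∧
      (∀ y ∈ graphOrbit x,
        diagValue (uniformChannel (graphRep n) (pureState x)) y =
          (Nat.card (graphStabilizer x) : ℂ) / (n.factorial : ℂ)) ∧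
      (1 : ℝ) / (n.factorial : ℝ) ≤ (Nat.card (graphStabilizer x) : ℝ) / (n.factorial : ℝ) ∧
      (∀ y : Edge n → Fin 2,
        uniformChannel (graphRep n) (pureState x) *ᵥ ket y =
          diagValue (uniformChannel (graphRep n) (pureState x)) y • ket y) ∧
      (∀ y : Edge n → Fin 2, y ∉ graphOrbit x →
        uniformChannel (graphRep n) (pureState x) *ᵥ ket y = 0 ∧
        diagValue (uniformChannel (graphRep n) (pureState x)) y = 0) ∧
      ∀ (l : ℕ) (y : Edge n → Fin 2),
        (generatorChannel (graphRep n) (starTranspositions n))^[l] (pureState x) *ᵥ ket y =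
          diagValue ((generatorChannel (graphRep n) (starTranspositions n))^[l] (pureState x)) y •
            ket y ∧
        (y ∉ graphOrbit x →
          (generatorChannel (graphRep n) (starTranspositions n))^[l] (pureState x) *ᵥ ket y = 0 ∧
          diagValue
            ((generatorChannel (graphRep n) (starTranspositions n))^[l] (pureState x)) y = 0) ∧
        ‖diagValue (uniformChannel (graphRep n) (pureState x) -
            (generatorChannel (graphRep n) (starTranspositions n))^[l] (pureState x)) y‖ ≤
          Real.sqrt (Nat.card (graphStabilizer x)) * Real.exp (-((l : ℝ) / (n : ℝ))) ∧
        Real.sqrt (Nat.card (graphStabilizer x)) * Real.exp (-((l : ℝ) / (n : ℝ))) ≤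
          Real.sqrt (n.factorial : ℝ) * Real.exp (-((l : ℝ) / (n : ℝ)))) := by
  refine ⟨⟨6, 2, by norm_num, by norm_num, fun n hn => efficientlyRepresentedWith_graphRep hn⟩,
    card_edge, fun n hn => ⟨graphRep_injective hn, log_factorial_lt hn,
      laplacianGap_starTranspositions hn⟩, ?_, ?_⟩
  · intro n p q hpq
    obtain ⟨c, hc, hl, hp⟩ := exists_neighbouring_swaps hpq
    refine ⟨c, hc, ?_, fun hn => hl.trans_lt (sub_two_mul_lt hn), hp⟩
    rcases le_or_gt 3 n with hn | hn
    · exact hl.trans (sub_two_mul_lt hn).le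
    -- With no third vertex the transposition acts trivially on edges, so the circuit is empty and
    -- matches the bound `0`.
    · rw [show n - 2 = 0 by omega, Nat.zero_mul] at hl
      omega
  · intro n hn x
    have hpos : 1 ≤ Nat.card (graphStabilizer x) := Nat.card_pos
    refine ⟨fun σ => graphOf_graphPerm σ x, fun y => mem_graphOrbit_iff_nonempty_iso,
      card_graphStabilizer x, uniformChannel_eq_smul_sum x,
      fun y hy => diagValue_uniformChannel hy, ?_, ?_, ?_, ?_⟩
    · gcongr
      exact_mod_cast hpos
    · intro y
      rw [uniformChannel_pureState]
      exact relabelledState_mulVec_ket x y _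
    · intro y hy
      rw [uniformChannel_pureState, relabelledState_mulVec_ket,
        diagValue_relabelledState_eq_zero hy]
      exact ⟨zero_smul _ _, rfl⟩
    · intro l y
      refine ⟨?_, ?_, norm_diagValue_uniformChannel_sub_le hn x l y, ?_⟩
      · rw [generatorChannel_iterate_pureState hn]
        exact relabelledState_mulVec_ket x y _
      · intro hy
        rw [generatorChannel_iterate_pureState hn, relabelledState_mulVec_ket,
          diagValue_relabelledState_eq_zero hy]
        exact ⟨zero_smul _ _, rfl⟩
      · gcongr
        exact_mod_cast card_graphStabilizer_le x
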